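/- Let $d\ge 1$ be an integer and let $0<a<b<c<1$ be real numbers. Then there exists a compact set $E\subset\mathbb{R}^d$ such that $$\underline{\dim}_{MB}E=a,\qquad \overline{\dim}_C E=b,\qquad \dim_P E=c.$$ Here $B(x,r)$ is the closed Euclidean ball and $|\cdot|$ denotes diameter, and the three dimensions are defined as follows. Modified lower box dimension: for bounded $F\subset\mathbb{R}^d$ and $r>0$ let $N_r(F)$ be the least number of sets of diameter at most $r$ that cover $F$, and let $\underline{\dim}_B F=\liminf_{r\to0^+}\frac{\log N_r(F)}{-\log r}$ for non-empty $F$ (and $\underline{\dim}_B\emptyset=0$). Then $$\underline{\dim}_{MB}E=\inf\Big\{\sup_i\,\underline{\dim}_B E_i:\ E\subset\bigcup_{i=1}^\infty E_i,\ \text{each } E_i \text{ compact}\Big\}.$$ Upper correlation dimension: $$\overline{\dim}_C E=\sup_{\mu}\ \limsup_{r\to0^+}\frac{\log\int\mu(B(x,r))\,d\mu(x)}{\log r},$$ where the supremum is over all Borel probability measures $\mu$ on $\mathbb{R}^d$ with $\mu(\mathbb{R}^d\setminus E)=0$. Packing dimension: $\dim_P E=\inf\{s\ge0:\mathcal{P}^s(E)=0\}$,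 where $$\mathcal{P}^s(E)=\inf\Big\{\sum_{i=1}^\infty\mathcal{P}^s_0(E_i):E\subset\bigcup_{i=1}^\infty E_i\Big\},\qquad \mathcal{P}^s_0(F)=\inf_{\delta>0}\ \sup\sum_i|B_i|^s,$$ the supremum being over all finite or countable families $\{B_i\}$ of pairwise disjoint closed balls with centres in $F$ and (positive) radii at most $\delta$. -/

import Mathlib

open MeasureTheory Filter Topology Set

noncomputable section

namespace FractalDim

variable {X : Type*} [MetricSpace X]

/-- `N_r(E)`: the least number of sets of diameter at most `r` that cover `E`
(used for bounded `E` in a Euclidean space and `r > 0`, where finite covers exist). -/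
def coveringNumber (r : ℝ) (E : Set X) : ℕ :=
  sInf {n : ℕ | ∃ U : Fin n → Set X,
    (∀ i, Metric.ediam (U i) ≤ ENNReal.ofReal r) ∧ E ⊆ ⋃ i, U i}

/-- Lower box-counting dimension, `liminf_{r → 0+} log N_r(E) / (- log r)`. -/
def lowerBoxDim (E : Set X) : EReal :=
  liminf (fun r : ℝ => ((Real.log (coveringNumber r E) / (-Real.log r) : ℝ) : EReal)) (𝓝[>] 0)

/-- Modified lower box dimension: the infimum over all countable covers of `E` by compact sets
of the supremum of the lower box dimensions of the covering sets. -/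
def modifiedLowerBoxDim (E : Set X) : EReal :=
  ⨅ (F : ℕ → Set X) (_ : ∀ i, IsCompact (F i)) (_ : E ⊆ ⋃ i, F i), ⨆ i, lowerBoxDim (F i)

/-- Upper correlation dimension of a measure,
`limsup_{r → 0+} log (∫ μ(B(x,r)) dμ(x)) / log r`, with closed balls `B(x,r)`.
(For a probability measure the integral lies in `[0, 1]`, so `toReal` loses nothing.) -/
def upperCorrDimMeasure [MeasurableSpace X] (μ : Measure X) : EReal :=
  limsup (fun r : ℝ =>
    ((Real.log (∫⁻ x, μ (Metric.closedBall x r) ∂μ).toReal / Real.log r : ℝ) : EReal)) (𝓝[>] 0)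

/-- Upper correlation dimension of a set: the supremum of the upper correlation dimensions of the
Borel probability measures supported by `E`. -/
def upperCorrDim [MeasurableSpace X] (E : Set X) : EReal :=
  ⨆ (μ : Measure X) (_ : IsProbabilityMeasure μ) (_ : μ Eᶜ = 0), upperCorrDimMeasure μ

/-- A `δ`-packing of `E`: a countable family of pairwise disjoint closed balls with centres in `E`
and radii in `(0, δ]`, each ball being given by the pair of its centre and radius. -/
structure IsPacking (δ : ℝ) (E : Set X) (P : Set (X × ℝ)) : Prop where
  countable : P.Countable
  center_mem : ∀ p ∈ P, p.1 ∈ E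
  radius_pos : ∀ p ∈ P, 0 < p.2
  radius_le : ∀ p ∈ P, p.2 ≤ δ
  disjoint : P.PairwiseDisjoint fun p => Metric.closedBall p.1 p.2

/-- `𝒫_δ^s(E)`: the supremum of `∑ |B_i|^s` over the `δ`-packings `{B_i}` of `E`,
where `|·|` is the diameter. -/
def packingPreDelta (s δ : ℝ) (E : Set X) : ENNReal :=
  ⨆ (P : Set (X × ℝ)) (_ : IsPacking δ E P),
    ∑' p : P, Metric.ediam (Metric.closedBall p.1.1 p.1.2) ^ s

/-- The `s`-dimensional packing premeasure. -/
def packingPremeasure (s : ℝ) (E : Set X) : ENNReal :=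
  ⨅ (δ : ℝ) (_ : 0 < δ), packingPreDelta s δ E

/-- The `s`-dimensional packing measure. -/
def packingMeasure (s : ℝ) (E : Set X) : ENNReal :=
  ⨅ (F : ℕ → Set X) (_ : E ⊆ ⋃ i, F i), ∑' i, packingPremeasure s (F i)

/-- Packing dimension, `inf {s ≥ 0 : 𝒫^s(E) = 0}`. -/
def packingDim (E : Set X) : EReal :=
  ⨅ (s : ℝ) (_ : 0 ≤ s) (_ : packingMeasure s E = 0), (s : EReal)

end FractalDim

end

/-! ### Coding of binary sequences by points of a metric space -/

namespace FractalDim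

/-! Code binary sequences by points of a Cantor set on a line in ratio `ρ`, where `ρ ^ c = 2⁻¹`. A
set determined at level `n` by `k` binary coordinates is covered by `2 ^ k` sets of diameter `ρ ^
n`, so `k = t * n` corresponds to dimension `t * c`. The whole Cantor set has dimension `c`, so
packing dimension at most `c` is automatic. The example is a union of two coded sets, with `α = a /
c`, `β = b / c` and windows `[(2j+1)!, (2j+2)!)`.

The homogeneous set has free levels of density `β` inside the windows and `α` outside. Factorial
growth makes everything before the last block negligible, so the proportion of free levels below `n`
is near `α` at window starts, near `β` at window ends, and always between them up to rounding. Fair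
coins on the free levels give the lower bounds `a` and `b`.

The exclusive set opens window `j` completely, but only to sequences that begin with the first `j`
terms of `z j`. Every finitely supported sequence is some `z j` for infinitely many `j`, so every
piece contains almost full trees at infinitely many scales; with Baire's theorem this gives packing
dimension at least `c`. For the other two dimensions it is negligible: few coordinates matter at
window starts, and away from one small cylinder window `j` is closed too. A nonatomic measure keeps
a fixed mass off any small set, and by Cauchy–Schwarz (`measure_sq_le_mul_lintegral`) such a mass on
a set with few cylinders bounds the correlation integral below. The same inequality handles measures
charging the homogeneous set or an atom. -/

lemma cantorFunction_mem_Icc {ρ : ℝ} (h0 : 0 ≤ ρ) (h1 : ρ < 1) (x : ℕ → Bool) :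
    0 ≤ Cardinal.cantorFunction ρ x ∧ (1 - ρ) * Cardinal.cantorFunction ρ x ≤ 1 := by
  refine ⟨tsum_nonneg fun n => Cardinal.cantorFunctionAux_nonneg h0, ?_⟩
  have h : Cardinal.cantorFunction ρ x ≤ Cardinal.cantorFunction ρ fun _ => true :=
    Cardinal.cantorFunction_le h0 h1 fun _ _ => rfl
  have h2 := Cardinal.cantorFunction_succ (fun _ => true) h0 h1
  simp only [cond_true] at h2
  have h3 : (1 - ρ) * Cardinal.cantorFunction ρ (fun _ => true) = 1 := by linarith
  calc _ ≤ (1 - ρ) * Cardinal.cantorFunction ρ (fun _ => true) := by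
        gcongr
    _ = 1 := h3

lemma abs_cantorFunction_sub_le {ρ : ℝ} (h0 : 0 < ρ) (h1 : ρ < 1) (n : ℕ) :
    ∀ x y : ℕ → Bool, (∀ i < n, x i = y i) →
      (1 - ρ) * |Cardinal.cantorFunction ρ x - Cardinal.cantorFunction ρ y| ≤ ρ ^ n := by
  induction n with
  | zero =>
    intro x y _
    obtain ⟨hx0, hx1⟩ := cantorFunction_mem_Icc h0.le h1 x
    obtain ⟨hy0, hy1⟩ := cantorFunction_mem_Icc h0.le h1 y
    have h : 0 < 1 - ρ := by linarith
    rw [← abs_of_pos h, ← abs_mul, pow_zero, abs_le]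
    constructor <;> nlinarith [mul_nonneg h.le hx0, mul_nonneg h.le hy0]
  | succ n ih =>
    intro x y hxy
    have := ih (fun i => x (i + 1)) (fun i => y (i + 1)) fun i hi => hxy _ (by omega)
    rw [Cardinal.cantorFunction_succ x h0.le h1, Cardinal.cantorFunction_succ y h0.le h1,
      hxy 0 (by omega), add_sub_add_left_eq_sub, ← mul_sub, abs_mul, abs_of_pos h0, pow_succ]
    nlinarith

/-- After normalization by `1 - ρ`, the first differing digit contributes `(1 - ρ) * ρ ^ n`, and the
tails can cancel at most `ρ * ρ ^ n` of it. -/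
lemma le_abs_cantorFunction_sub {ρ : ℝ} (h0 : 0 < ρ) (h1 : ρ < 1) (n : ℕ) :
    ∀ x y : ℕ → Bool, (∀ i < n, x i = y i) → x n ≠ y n →
      (1 - 2 * ρ) * ρ ^ n ≤
        (1 - ρ) * |Cardinal.cantorFunction ρ x - Cardinal.cantorFunction ρ y| := by
  induction n with
  | zero =>
    intro x y _ hne
    have h := abs_cantorFunction_sub_le h0 h1 0 (fun i => x (i + 1)) (fun i => y (i + 1))
      (by simp)
    have h' : 0 < 1 - ρ := by linarith
    rw [Cardinal.cantorFunction_succ x h0.le h1, Cardinal.cantorFunction_succ y h0.le h1]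
    set u := Cardinal.cantorFunction ρ fun i => x (i + 1)
    set v := Cardinal.cantorFunction ρ fun i => y (i + 1)
    rw [← abs_of_pos h', ← abs_mul, pow_zero, abs_le] at h
    rw [← abs_of_pos h', ← abs_mul, pow_zero]
    cases hx : x 0 <;> cases hy : y 0 <;> simp_all only [ne_eq, not_true_eq_false, cond_true,
      cond_false]
    · refine le_trans ?_ (neg_le_abs _)
      nlinarith
    · refine le_trans ?_ (le_abs_self _)
      nlinarith
  | succ n ih =>
    intro x y hxy hne
    have := ih (fun i => x (i + 1)) (fun i => y (i + 1)) (fun i hi => hxy _ (by omega)) hne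
    rw [Cardinal.cantorFunction_succ x h0.le h1, Cardinal.cantorFunction_succ y h0.le h1,
      hxy 0 (by omega), add_sub_add_left_eq_sub, ← mul_sub, abs_mul, abs_of_pos h0, pow_succ]
    nlinarith

/-- A coding of binary sequences by points of a metric space for which cylinders of length `n` have
diameter at most `ρ ^ n` and distance at least `κ * ρ ^ n` from each other. -/
structure IsCantorCoding {X : Type*} [MetricSpace X] (ρ κ : ℝ) (π : (ℕ → Bool) → X) : Prop where
  pos : 0 < ρ
  lt_one : ρ < 1
  sep_pos : 0 < κ
  dist_le : ∀ (x y : ℕ → Bool) (n : ℕ), (∀ i < n, x i = y i) → dist (π x) (π y) ≤ ρ ^ n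
  le_dist : ∀ (x y : ℕ → Bool) (n : ℕ), (∃ i < n, x i ≠ y i) → κ * ρ ^ n ≤ dist (π x) (π y)

lemma exists_isCantorCoding {d : ℕ} (hd : 1 ≤ d) {ρ : ℝ} (h0 : 0 < ρ) (h1 : ρ < 1 / 2) :
    ∃ (κ : ℝ) (π : (ℕ → Bool) → EuclideanSpace ℝ (Fin d)), IsCantorCoding ρ κ π := by
  have hρ : ρ < 1 := by linarith
  have hdist : ∀ x y : ℕ → Bool,
      dist (EuclideanSpace.single (⟨0, hd⟩ : Fin d) ((1 - ρ) * Cardinal.cantorFunction ρ x))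
        (EuclideanSpace.single (⟨0, hd⟩ : Fin d) ((1 - ρ) * Cardinal.cantorFunction ρ y)) =
      (1 - ρ) * |Cardinal.cantorFunction ρ x - Cardinal.cantorFunction ρ y| := by
    intro x y
    rw [PiLp.dist_single_same, Real.dist_eq, ← mul_sub, abs_mul,
      abs_of_pos (by linarith : 0 < 1 - ρ)]
  refine ⟨1 - 2 * ρ, fun x => EuclideanSpace.single ⟨0, hd⟩
    ((1 - ρ) * Cardinal.cantorFunction ρ x), h0, hρ, by linarith, ?_, ?_⟩
  · intro x y n h
    rw [hdist]
    exact abs_cantorFunction_sub_le h0 hρ n x y h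
  · intro x y n h
    classical
    rw [hdist]
    have hm := Nat.find_spec h
    -- The separation is governed by the first disagreement, at a level below `n`, where the gap is
    -- only larger.
    refine le_trans ?_ (le_abs_cantorFunction_sub h0 hρ (Nat.find h) x y (fun i hi => ?_) hm.2)
    · have : ρ ^ n ≤ ρ ^ Nat.find h := pow_le_pow_of_le_one h0.le hρ.le hm.1.le
      have : 0 < 1 - 2 * ρ := by linarith
      gcongr
    · by_contra hne
      exact Nat.find_min h hi ⟨hi.trans hm.1, hne⟩

/-- On `K`, the coordinates in `I` determine the first `n` coordinates. -/
def Determines (I : Finset ℕ) (n : ℕ) (K : Set (ℕ → Bool)) : Prop :=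
  ∀ x ∈ K, ∀ y ∈ K, (∀ i ∈ I, x i = y i) → ∀ i < n, x i = y i

variable {X : Type*} [MetricSpace X] {ρ κ : ℝ} {π : (ℕ → Bool) → X}

lemma IsCantorCoding.continuous (hπ : IsCantorCoding ρ κ π) : Continuous π := by
  rw [continuous_iff_continuousAt]
  intro x
  rw [ContinuousAt, Metric.tendsto_nhds]
  intro ε hε
  obtain ⟨n, hn⟩ := exists_pow_lt_of_lt_one hε hπ.lt_one
  filter_upwards [(PiNat.isOpen_cylinder (fun _ : ℕ => Bool) x n).mem_nhds
    (PiNat.self_mem_cylinder x n)] with y hy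
  exact (hπ.dist_le y x n hy).trans_lt hn

lemma IsCantorCoding.exists_cover (hπ : IsCantorCoding ρ κ π) {I : Finset ℕ} {n : ℕ}
    {K : Set (ℕ → Bool)} (h : Determines I n K) :
    ∃ U : Fin (2 ^ I.card) → Set X,
      (∀ i, Metric.ediam (U i) ≤ ENNReal.ofReal (ρ ^ n)) ∧ π '' K ⊆ ⋃ i, U i := by
  classical
  have e : Fin (2 ^ I.card) ≃ (I → Bool) := (Fintype.equivFinOfCardEq (by simp)).symm
  refine ⟨fun j => π '' {x ∈ K | ∀ i : I, x i = e j i}, fun j => ?_, ?_⟩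
  · refine Metric.ediam_le ?_
    rintro _ ⟨x, ⟨hx, hxe⟩, rfl⟩ _ ⟨y, ⟨hy, hye⟩, rfl⟩
    rw [edist_dist]
    refine ENNReal.ofReal_le_ofReal (hπ.dist_le x y n (h x hx y hy fun i hi => ?_))
    rw [hxe ⟨i, hi⟩, hye ⟨i, hi⟩]
  · rintro _ ⟨x, hx, rfl⟩
    exact mem_iUnion.2 ⟨e.symm fun i => x i, x, ⟨hx, by simp⟩, rfl⟩

/-! ### Covering numbers and the correlation integral -/

lemma coveringNumber_le {r : ℝ} {E : Set X} {N : ℕ} (U : Fin N → Set X)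
    (hU : ∀ i, Metric.ediam (U i) ≤ ENNReal.ofReal r) (hE : E ⊆ ⋃ i, U i) :
    coveringNumber r E ≤ N :=
  Nat.sInf_le ⟨U, hU, hE⟩

/-- Compactness supplies some finite cover; without one the infimum would be the default `sInf ∅ =
0`. -/
lemma exists_cover_coveringNumber {r : ℝ} (hr : 0 < r) {E : Set X} (hE : IsCompact E) :
    ∃ U : Fin (coveringNumber r E) → Set X,
      (∀ i, Metric.ediam (U i) ≤ ENNReal.ofReal r) ∧ E ⊆ ⋃ i, U i := by
  refine Nat.sInf_mem (s := {n : ℕ | ∃ U : Fin n → Set X,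
    (∀ i, Metric.ediam (U i) ≤ ENNReal.ofReal r) ∧ E ⊆ ⋃ i, U i}) ?_
  obtain ⟨t, -, ht, hEt⟩ := hE.finite_cover_balls (half_pos hr)
  have := ht.fintype
  refine ⟨Fintype.card t, fun j => Metric.ball ((Fintype.equivFin t).symm j : X) (r / 2),
    fun j => ?_, fun x hx => ?_⟩
  · refine Metric.ediam_le fun x hx y hy => ?_
    rw [edist_dist]
    refine ENNReal.ofReal_le_ofReal ?_
    have := dist_triangle_right x y ((Fintype.equivFin t).symm j : X)
    rw [Metric.mem_ball] at hx hy
    linarith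
  · obtain ⟨y, hy, hxy⟩ := mem_iUnion₂.1 (hEt hx)
    exact mem_iUnion.2 ⟨Fintype.equivFin t ⟨y, hy⟩, by simpa using hxy⟩

/-- Make the closures of the cover disjoint. A ball of radius `r` about a point of a piece contains
that piece, so the integral dominates the sum of the squared masses, and Cauchy–Schwarz applies. -/
lemma measure_sq_le_mul_lintegral [MeasurableSpace X] [BorelSpace X] (μ : Measure X)
    {r : ℝ} (hr : 0 ≤ r) {S : Set X} {N : ℕ} (U : Fin N → Set X)
    (hU : ∀ i, Metric.ediam (U i) ≤ ENNReal.ofReal r) (hS : S ⊆ ⋃ i, U i) :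
    μ S ^ 2 ≤ N * ∫⁻ x, μ (Metric.closedBall x r) ∂μ := by
  set D : Fin N → Set X := disjointed fun i => closure (U i) with hD
  have hDm : ∀ i, MeasurableSet (D i) := fun i => by
    rw [hD, disjointed_apply, Finset.sup_set_eq_biUnion]
    exact isClosed_closure.measurableSet.diff
      (Finset.measurableSet_biUnion _ fun i _ => isClosed_closure.measurableSet)
  have hDd : Pairwise (Function.onFun Disjoint D) := disjoint_disjointed _
  have hDU : ∀ i, D i ⊆ closure (U i) := disjointed_subset _
  have hSD : S ⊆ ⋃ i, D i := by
    rw [hD, iUnion_disjointed]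
    exact hS.trans (iUnion_mono fun i => subset_closure)
  have hball : ∀ i, ∀ x ∈ D i, D i ⊆ Metric.closedBall x r := by
    intro i x hx y hy
    rw [Metric.mem_closedBall, ← ENNReal.ofReal_le_ofReal_iff hr, ← edist_dist]
    refine (Metric.edist_le_ediam_of_mem (hDU i hy) (hDU i hx)).trans ?_
    rw [Metric.ediam_closure]
    exact hU i
  calc μ S ^ 2 ≤ (∑ i, μ (D i)) ^ 2 := by
        gcongr
        refine (measure_mono hSD).trans ?_
        rw [← tsum_fintype (L := .unconditional _)]
        exact measure_iUnion_le _
    _ ≤ N * ∑ i, μ (D i) ^ 2 := by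
        have := ENNReal.rpow_sum_le_const_mul_sum_rpow Finset.univ (fun i => μ (D i))
          (p := 2) one_le_two
        norm_num at this
        exact_mod_cast this
    _ ≤ N * ∑ i, ∫⁻ x in D i, μ (Metric.closedBall x r) ∂μ := by
        gcongr with i
        rw [sq, ← setLIntegral_const]
        exact setLIntegral_mono' (hDm i) fun x hx => measure_mono (hball i x hx)
    _ = N * ∫⁻ x in ⋃ i, D i, μ (Metric.closedBall x r) ∂μ := by
        rw [lintegral_iUnion hDm hDd, tsum_fintype]
    _ ≤ N * ∫⁻ x, μ (Metric.closedBall x r) ∂μ := by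
        gcongr
        exact Measure.restrict_le_self

/-! ### The fair coin measure on binary sequences -/

/-- The distribution of a sequence of independent fair coin tosses. -/
noncomputable def coinMeasure : Measure (ℕ → Bool) :=
  Measure.infinitePi fun _ => (PMF.uniformOfFintype Bool).toMeasure

instance : IsProbabilityMeasure coinMeasure := by
  unfold coinMeasure; infer_instance

lemma coinMeasure_agree (I : Finset ℕ) (x : ℕ → Bool) :
    coinMeasure {y | ∀ i ∈ I, y i = x i} = 2⁻¹ ^ I.card := by
  have : {y : ℕ → Bool | ∀ i ∈ I, y i = x i} = Set.pi (I : Set ℕ) fun i => {x i} := by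
    ext y; simp [Set.mem_pi]
  rw [this, coinMeasure, Measure.infinitePi_pi _ fun i _ => measurableSet_singleton _]
  simp

/-- A set of diameter below the separation `κ * ρ ^ n` meets only one cylinder of length `n`, so the
tosses in `I` are forced. -/
lemma IsCantorCoding.coinMeasure_preimage_le (hπ : IsCantorCoding ρ κ π) {I : Finset ℕ} {n : ℕ}
    {g : (ℕ → Bool) → ℕ → Bool} (hg : ∀ x y, (∀ i < n, g x i = g y i) → ∀ i ∈ I, x i = y i)
    {S : Set X} {r : ℝ} (hS : Metric.ediam S ≤ ENNReal.ofReal r) (hr : r < κ * ρ ^ n) :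
    coinMeasure ((fun x => π (g x)) ⁻¹' S) ≤ 2⁻¹ ^ I.card := by
  rcases ((fun x => π (g x)) ⁻¹' S).eq_empty_or_nonempty with h | ⟨x, hx⟩
  · simp [h]
  rw [← coinMeasure_agree I x]
  refine measure_mono fun y hy => hg y x ?_
  by_contra! hne
  have h0 : 0 < κ * ρ ^ n := mul_pos hπ.sep_pos (pow_pos hπ.pos n)
  have h1 := (Metric.edist_le_ediam_of_mem (mem_preimage.1 hy) (mem_preimage.1 hx)).trans hS
  rw [edist_dist] at h1
  have h2 := hπ.le_dist (g y) (g x) n hne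
  rw [ENNReal.ofReal_le_ofReal_iff'] at h1
  rcases h1 with h1 | h1 <;> linarith

lemma IsCantorCoding.le_coinMeasure_preimage (hπ : IsCantorCoding ρ κ π) {n : ℕ} {r : ℝ}
    (hr : ρ ^ n ≤ r) (x : ℕ → Bool) :
    2⁻¹ ^ n ≤ coinMeasure (π ⁻¹' Metric.closedBall (π x) r) := by
  rw [← Finset.card_range n, ← coinMeasure_agree _ x]
  exact measure_mono fun y hy =>
    (hπ.dist_le y x n fun i hi => hy i (Finset.mem_range.2 hi)).trans hr

/-! ### Growth exponents -/

lemma tendsto_div_log_nhdsGT_zero (C : ℝ) :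
    Tendsto (fun r : ℝ => C / Real.log r) (𝓝[>] 0) (𝓝 0) :=
  Real.tendsto_log_nhdsGT_zero.const_div_atBot C

lemma limsup_log_div_log_le {I : ℝ → ℝ} {C b : ℝ} (hC : 0 < C)
    (h : ∀ᶠ r in 𝓝[>] (0 : ℝ), C * r ^ b ≤ I r) :
    limsup (fun r : ℝ => ((Real.log (I r) / Real.log r : ℝ) : EReal)) (𝓝[>] 0) ≤ (b : EReal) := by
  have hlim : Tendsto (fun r : ℝ => ((Real.log C / Real.log r + b : ℝ) : EReal)) (𝓝[>] 0)
      (𝓝 (b : EReal)) := by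
    refine (continuous_coe_real_ereal.tendsto b).comp ?_
    simpa using (tendsto_div_log_nhdsGT_zero (Real.log C)).add_const b
  rw [← hlim.limsup_eq]
  refine limsup_le_limsup ?_
  filter_upwards [h, Ioo_mem_nhdsGT (zero_lt_one' ℝ)] with r hr ⟨h0, h1⟩
  rw [EReal.coe_le_coe_iff]
  have hlog : Real.log r < 0 := Real.log_neg h0 h1
  have hrb : 0 < r ^ b := Real.rpow_pos_of_pos h0 b
  have h2 := Real.log_le_log (mul_pos hC hrb) hr
  rw [Real.log_mul hC.ne' hrb.ne', Real.log_rpow h0] at h2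
  rw [div_add' _ _ _ hlog.ne]
  exact div_le_div_of_nonpos_of_le hlog.le h2

lemma le_liminf_log_div_neg_log {N : ℝ → ℝ} {C a : ℝ} (hC : 0 < C)
    (h : ∀ᶠ r in 𝓝[>] (0 : ℝ), C * r ^ (-a) ≤ N r) :
    (a : EReal) ≤
      liminf (fun r : ℝ => ((Real.log (N r) / (-Real.log r) : ℝ) : EReal)) (𝓝[>] 0) := by
  have hlim : Tendsto (fun r : ℝ => ((-Real.log C / Real.log r + a : ℝ) : EReal)) (𝓝[>] 0)
      (𝓝 (a : EReal)) := by
    refine (continuous_coe_real_ereal.tendsto a).comp ?_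
    simpa using (tendsto_div_log_nhdsGT_zero (-Real.log C)).add_const a
  rw [← hlim.liminf_eq]
  refine liminf_le_liminf ?_
  filter_upwards [h, Ioo_mem_nhdsGT (zero_lt_one' ℝ)] with r hr ⟨h0, h1⟩
  rw [EReal.coe_le_coe_iff]
  have hlog : Real.log r < 0 := Real.log_neg h0 h1
  have hrb : 0 < r ^ (-a) := Real.rpow_pos_of_pos h0 _
  have h2 := Real.log_le_log (mul_pos hC hrb) hr
  rw [Real.log_mul hC.ne' hrb.ne', Real.log_rpow h0] at h2
  rw [div_add' _ _ _ hlog.ne, div_neg, ← neg_div]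
  exact div_le_div_of_nonpos_of_le hlog.le (by linarith)

lemma liminf_le_of_tendsto_seq {α : Type*} {F : Filter α} {f : α → EReal} {u : ℕ → α}
    {v : ℕ → ℝ} {a : ℝ} (hu : Tendsto u atTop F) (hv : Tendsto v atTop (𝓝 a))
    (h : ∀ᶠ j in atTop, f (u j) ≤ (v j : EReal)) : liminf f F ≤ (a : EReal) := by
  have hlim : Tendsto (fun j => (v j : EReal)) atTop (𝓝 (a : EReal)) :=
    (continuous_coe_real_ereal.tendsto a).comp hv
  calc liminf f F ≤ liminf f (map u atTop) := liminf_le_liminf_of_le hu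
    _ ≤ liminf (fun j => (v j : EReal)) atTop := liminf_le_liminf h
    _ = a := hlim.liminf_eq

lemma le_limsup_of_tendsto_seq {α : Type*} {F : Filter α} {f : α → EReal} {u : ℕ → α}
    {v : ℕ → ℝ} {a : ℝ} (hu : Tendsto u atTop F) (hv : Tendsto v atTop (𝓝 a))
    (h : ∀ᶠ j in atTop, (v j : EReal) ≤ f (u j)) : (a : EReal) ≤ limsup f F := by
  have hlim : Tendsto (fun j => (v j : EReal)) atTop (𝓝 (a : EReal)) :=
    (continuous_coe_real_ereal.tendsto a).comp hv
  calc (a : EReal) = limsup (fun j => (v j : EReal)) atTop := hlim.limsup_eq.symm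
    _ ≤ limsup f (map u atTop) := limsup_le_limsup h
    _ ≤ limsup f F := limsup_le_limsup_of_le hu

lemma eventually_exists_scale {ρ κ : ℝ} (h0 : 0 < ρ) (h1 : ρ < 1) (hκ : 0 < κ) (n₀ : ℕ) :
    ∀ᶠ r in 𝓝[>] (0 : ℝ), ∃ n, n₀ ≤ n ∧ κ * ρ ^ (n + 1) < r ∧ r ≤ κ * ρ ^ n := by
  filter_upwards [Ioo_mem_nhdsGT (mul_pos hκ (pow_pos h0 n₀))] with r ⟨hr0, hr⟩
  have hr' : r / κ < ρ ^ n₀ := by rwa [div_lt_iff₀' hκ]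
  obtain ⟨n, hn1, hn2⟩ := exists_nat_pow_near_of_lt_one (div_pos hr0 hκ)
    (hr'.le.trans (pow_le_one₀ h0.le h1.le)) h0 h1
  refine ⟨n, ?_, (lt_div_iff₀' hκ).1 hn1, (div_le_iff₀' hκ).1 hn2⟩
  by_contra! hlt
  have := pow_le_pow_of_le_one h0.le h1.le (show n + 1 ≤ n₀ by omega)
  linarith

lemma tendsto_mul_pow_nhdsGT_zero {ρ κ : ℝ} (h0 : 0 < ρ) (h1 : ρ < 1) (hκ : 0 < κ) {s : ℕ → ℕ}
    (hs : Tendsto s atTop atTop) : Tendsto (fun j => κ * ρ ^ s j) atTop (𝓝[>] 0) := by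
  rw [tendsto_nhdsWithin_iff]
  constructor
  · simpa using ((tendsto_pow_atTop_nhds_zero_of_lt_one h0.le h1).comp hs).const_mul κ
  · exact Eventually.of_forall fun j => mul_pos hκ (pow_pos h0 _)

lemma half_rpow_eq {ρ c : ℝ} (h0 : 0 < ρ) (hρc : ρ ^ c = 2⁻¹) (t : ℝ) (n : ℕ) :
    (2⁻¹ : ℝ) ^ (t * n) = (ρ ^ n) ^ (t * c) := by
  rw [← hρc, ← Real.rpow_mul h0.le, ← Real.rpow_natCast ρ, ← Real.rpow_mul h0.le]
  ring_nf

variable {X : Type*} [MetricSpace X] {ρ κ c : ℝ} {π : (ℕ → Bool) → X}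

/-! ### Dimension estimates for coded sets -/

lemma lowerBoxDim_image_le (hπ : IsCantorCoding ρ κ π) (hρc : ρ ^ c = 2⁻¹)
    {K : Set (ℕ → Bool)} {s : ℕ → ℕ} {q : ℕ → ℝ} {α : ℝ} (hs : Tendsto s atTop atTop)
    (hq : Tendsto (fun j => q j / s j) atTop (𝓝 α))
    (h : ∀ j, ∃ I : Finset ℕ, Determines I (s j) K ∧ (I.card : ℝ) ≤ q j) :
    lowerBoxDim (π '' K) ≤ ((α * c : ℝ) : EReal) := by
  have hu := tendsto_mul_pow_nhdsGT_zero hπ.pos hπ.lt_one one_pos hs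
  refine liminf_le_of_tendsto_seq hu (hq.mul_const c) ?_
  filter_upwards [hs.eventually_ge_atTop 1] with j hj
  rw [EReal.coe_le_coe_iff, one_mul]
  obtain ⟨I, hI, hIq⟩ := h j
  obtain ⟨U, hU, hKU⟩ := hπ.exists_cover hI
  have hN : Real.log (coveringNumber (ρ ^ s j) (π '' K)) ≤ I.card * Real.log 2 := by
    rw [← Real.log_pow]
    -- For empty `K` the covering number is `0`, whose real logarithm is `0` by convention.
    rcases Nat.eq_zero_or_pos (coveringNumber (ρ ^ s j) (π '' K)) with h0 | h0
    · rw [h0]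
      simpa using Real.log_nonneg (one_le_pow₀ (one_le_two (α := ℝ)))
    · refine Real.log_le_log (by exact_mod_cast h0) ?_
      exact_mod_cast coveringNumber_le U hU hKU
  have hlog : Real.log 2 = c * -Real.log ρ := by
    have := congrArg Real.log hρc
    rw [Real.log_rpow hπ.pos, Real.log_inv] at this
    linarith
  have hρ : 0 < -Real.log ρ := by linarith [Real.log_neg hπ.pos hπ.lt_one]
  have hsj : (0 : ℝ) < s j := by exact_mod_cast hj
  have h2 : 0 < Real.log 2 := Real.log_pos one_lt_two
  rw [Real.log_pow, ← mul_neg, div_le_iff₀ (mul_pos hsj hρ)]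
  calc _ ≤ I.card * Real.log 2 := hN
    _ ≤ q j * Real.log 2 := by gcongr
    _ = _ := by rw [hlog]; field_simp

/-- Mass distribution: each covering set carries mass at most `2⁻¹ ^ I.card`, so covering a fixed
positive mass takes a comparable multiple of `2 ^ I.card` sets. -/
lemma le_lowerBoxDim_of_coinMeasure_ne_zero (hπ : IsCantorCoding ρ κ π) (hρc : ρ ^ c = 2⁻¹)
    (hc : 0 < c) {g : (ℕ → Bool) → ℕ → Bool} {α : ℝ} (hα : 0 ≤ α)
    (hg : ∀ n : ℕ, ∃ I : Finset ℕ, α * n - 1 ≤ I.card ∧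
      ∀ x y, (∀ i < n, g x i = g y i) → ∀ i ∈ I, x i = y i)
    {F : Set X} (hF : IsCompact F) (hF0 : coinMeasure ((fun x => π (g x)) ⁻¹' F) ≠ 0) :
    ((α * c : ℝ) : EReal) ≤ lowerBoxDim F := by
  set δ : ℝ := (coinMeasure ((fun x => π (g x)) ⁻¹' F)).toReal with hδ
  have hδ0 : 0 < δ := ENNReal.toReal_pos hF0 (measure_ne_top _ _)
  have hκ2 : 0 < κ / 2 := half_pos hπ.sep_pos
  have hκρ : 0 < κ / 2 * ρ := mul_pos hκ2 hπ.pos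
  -- The factor `2⁻¹` pays for the `- 1` in `hg`, the last factor for replacing `ρ ^ n` by `r`.
  refine le_liminf_log_div_neg_log (C := δ * 2⁻¹ * (κ / 2 * ρ) ^ (α * c)) (by positivity) ?_
  filter_upwards [eventually_exists_scale hπ.pos hπ.lt_one hκ2 0, self_mem_nhdsWithin]
    with r ⟨n, _, hn1, hn2⟩ hr0
  rw [mem_Ioi] at hr0
  obtain ⟨I, hI, hgI⟩ := hg n
  obtain ⟨U, hU, hFU⟩ := exists_cover_coveringNumber hr0 hF
  have hpow : 0 < ρ ^ n := pow_pos hπ.pos n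
  have hsum : coinMeasure ((fun x => π (g x)) ⁻¹' F) ≤ coveringNumber r F * 2⁻¹ ^ I.card := by
    calc coinMeasure ((fun x => π (g x)) ⁻¹' F)
        ≤ coinMeasure (⋃ i, (fun x => π (g x)) ⁻¹' U i) := by
          rw [← preimage_iUnion]; exact measure_mono (preimage_mono hFU)
      _ ≤ ∑ i, coinMeasure ((fun x => π (g x)) ⁻¹' U i) := by
          rw [← tsum_fintype (L := .unconditional _)]
          exact measure_iUnion_le _
      _ ≤ ∑ _i : Fin (coveringNumber r F), 2⁻¹ ^ I.card := by
          gcongr with i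
          refine hπ.coinMeasure_preimage_le hgI (hU i) (hn2.trans_lt ?_)
          nlinarith [mul_pos hκ2 hpow]
      _ = coveringNumber r F * 2⁻¹ ^ I.card := by simp
  have hδN : δ ≤ coveringNumber r F * 2⁻¹ ^ I.card := by
    have := ENNReal.toReal_mono (by finiteness) hsum
    simpa using this
  have hcard : (2⁻¹ : ℝ) ^ I.card ≤ 2 * (r / (κ / 2 * ρ)) ^ (α * c) := by
    calc (2⁻¹ : ℝ) ^ I.card = 2⁻¹ ^ (I.card : ℝ) := (Real.rpow_natCast _ _).symm
      _ ≤ 2⁻¹ ^ (α * n - 1) :=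
          Real.rpow_le_rpow_of_exponent_ge (by norm_num) (by norm_num) hI
      _ = 2 * (ρ ^ n) ^ (α * c) := by
          rw [Real.rpow_sub (by norm_num), half_rpow_eq hπ.pos hρc, Real.rpow_one]
          ring
      _ ≤ 2 * (r / (κ / 2 * ρ)) ^ (α * c) := by
          gcongr
          rw [le_div_iff₀ hκρ]
          calc _ = κ / 2 * ρ ^ (n + 1) := by ring
            _ ≤ r := hn1.le
  rw [Real.rpow_neg hr0.le, ← div_eq_mul_inv, div_le_iff₀ (by positivity)]
  calc δ * 2⁻¹ * (κ / 2 * ρ) ^ (α * c)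
      ≤ coveringNumber r F * (2 * (r / (κ / 2 * ρ)) ^ (α * c)) * 2⁻¹ * (κ / 2 * ρ) ^ (α * c) := by
        gcongr
        exact hδN.trans (by gcongr)
    _ = coveringNumber r F * r ^ (α * c) := by
        rw [Real.div_rpow hr0.le hκρ.le]
        have hw : (κ / 2 * ρ) ^ (α * c) ≠ 0 := by positivity
        generalize (κ / 2 * ρ) ^ (α * c) = w at hw
        field_simp

/-! ### Correlation dimension of coded measures -/

section Correlation

variable [MeasurableSpace X] [BorelSpace X]

/-- The carrier `K` may change with `n`; only the lower bound `δ` on its mass must be uniform. The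
exclusive set needs this freedom. -/
lemma exists_le_corrIntegral (hπ : IsCantorCoding ρ κ π) (hρc : ρ ^ c = 2⁻¹) (hc : 0 < c)
    (μ : Measure X) [IsProbabilityMeasure μ] {δ : ENNReal} (hδ : δ ≠ 0) {β : ℝ} (hβ : 0 ≤ β)
    {n₀ : ℕ} (h : ∀ n ≥ n₀, ∃ (K : Set (ℕ → Bool)) (I : Finset ℕ), Determines I n K ∧
      (I.card : ℝ) ≤ β * n ∧ δ ≤ μ (π '' K)) :
    ∃ C > 0, ∀ᶠ r in 𝓝[>] (0 : ℝ),
      C * r ^ (β * c) ≤ (∫⁻ x, μ (Metric.closedBall x r) ∂μ).toReal := by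
  have hδt : δ ≠ ⊤ := by
    obtain ⟨K, I, -, -, hK⟩ := h n₀ le_rfl
    exact ne_top_of_le_ne_top (measure_ne_top _ _) hK
  have hδ0 : 0 < δ.toReal := ENNReal.toReal_pos hδ hδt
  have hρ := hπ.pos
  refine ⟨δ.toReal ^ 2 * ρ ^ (β * c), by positivity, ?_⟩
  filter_upwards [eventually_exists_scale hπ.pos hπ.lt_one one_pos n₀, self_mem_nhdsWithin]
    with r ⟨n, hn, hn1, hn2⟩ hr0
  rw [mem_Ioi] at hr0
  rw [one_mul] at hn1 hn2
  obtain ⟨K, I, hKI, hIc, hK⟩ := h (n + 1) (by omega)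
  obtain ⟨U, hU, hKU⟩ := hπ.exists_cover hKI
  have h1 := measure_sq_le_mul_lintegral μ hr0.le U
    (fun i => (hU i).trans (ENNReal.ofReal_le_ofReal hn1.le)) hKU
  have hfin : ∫⁻ x, μ (Metric.closedBall x r) ∂μ ≠ ⊤ := by
    refine ne_top_of_le_ne_top ENNReal.one_ne_top ?_
    calc ∫⁻ x, μ (Metric.closedBall x r) ∂μ ≤ ∫⁻ _, 1 ∂μ := lintegral_mono fun x => prob_le_one
      _ = 1 := by simp
  have h2 : δ.toReal ^ 2 ≤ 2 ^ I.card * (∫⁻ x, μ (Metric.closedBall x r) ∂μ).toReal := by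
    have := ENNReal.toReal_mono (by finiteness) ((pow_le_pow_left' hK 2).trans h1)
    simpa using this
  have h3 : ρ ^ (β * c) * r ^ (β * c) ≤ (2⁻¹ : ℝ) ^ I.card := by
    rw [← Real.mul_rpow hρ.le hr0.le]
    calc (ρ * r) ^ (β * c) ≤ (ρ ^ (n + 1)) ^ (β * c) := by
          gcongr
          rw [pow_succ']
          gcongr
      _ = 2⁻¹ ^ (β * (n + 1 : ℕ)) := (half_rpow_eq hρ hρc β (n + 1)).symm
      _ ≤ 2⁻¹ ^ (I.card : ℝ) :=
          Real.rpow_le_rpow_of_exponent_ge (by norm_num) (by norm_num) hIc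
      _ = 2⁻¹ ^ I.card := Real.rpow_natCast _ _
  calc δ.toReal ^ 2 * ρ ^ (β * c) * r ^ (β * c)
      = δ.toReal ^ 2 * (ρ ^ (β * c) * r ^ (β * c)) := by ring
    _ ≤ 2 ^ I.card * (∫⁻ x, μ (Metric.closedBall x r) ∂μ).toReal * 2⁻¹ ^ I.card := by gcongr
    _ = (∫⁻ x, μ (Metric.closedBall x r) ∂μ).toReal := by
        rw [inv_pow]; field_simp

lemma upperCorrDimMeasure_le (hπ : IsCantorCoding ρ κ π) (hρc : ρ ^ c = 2⁻¹) (hc : 0 < c)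
    (μ : Measure X) [IsProbabilityMeasure μ] {δ : ENNReal} (hδ : δ ≠ 0) {β : ℝ} (hβ : 0 ≤ β)
    {n₀ : ℕ} (h : ∀ n ≥ n₀, ∃ (K : Set (ℕ → Bool)) (I : Finset ℕ), Determines I n K ∧
      (I.card : ℝ) ≤ β * n ∧ δ ≤ μ (π '' K)) :
    upperCorrDimMeasure μ ≤ ((β * c : ℝ) : EReal) := by
  obtain ⟨C, hC, hCr⟩ := exists_le_corrIntegral hπ hρc hc μ hδ hβ h
  exact limsup_log_div_log_le hC hCr

/-- At the scales `s j` every ball has mass at most `2⁻¹ ^ I.card`, hence so does the average.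
Positivity of the integral is required because `Real.log 0 = 0`. -/
lemma le_upperCorrDimMeasure_map_coinMeasure (hπ : IsCantorCoding ρ κ π) (hρc : ρ ^ c = 2⁻¹)
    {g : (ℕ → Bool) → ℕ → Bool} (hgm : Measurable g) {s : ℕ → ℕ} {q : ℕ → ℝ} {β : ℝ}
    (hs : Tendsto s atTop atTop) (hq : Tendsto (fun j => q j / s j) atTop (𝓝 β))
    (hg : ∀ j, ∃ I : Finset ℕ, q j ≤ I.card ∧
      ∀ x y, (∀ i < s j, g x i = g y i) → ∀ i ∈ I, x i = y i)
    (hpos : ∀ᶠ r in 𝓝[>] (0 : ℝ), 0 < (∫⁻ x, coinMeasure.map (fun x => π (g x))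
      (Metric.closedBall x r) ∂(coinMeasure.map fun x => π (g x))).toReal) :
    ((β * c : ℝ) : EReal) ≤ upperCorrDimMeasure (coinMeasure.map fun x => π (g x)) := by
  have hmeas : Measurable fun x => π (g x) := hπ.continuous.measurable.comp hgm
  set ν := coinMeasure.map fun x => π (g x) with hν
  have : IsProbabilityMeasure ν := Measure.isProbabilityMeasure_map hmeas.aemeasurable
  have hκ4 : 0 < κ / 4 := by linarith [hπ.sep_pos]
  have hu := tendsto_mul_pow_nhdsGT_zero hπ.pos hπ.lt_one hκ4 hs
  have hlogρ : Real.log ρ < 0 := Real.log_neg hπ.pos hπ.lt_one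
  have hlog : Real.log 2 = c * -Real.log ρ := by
    have := congrArg Real.log hρc
    rw [Real.log_rpow hπ.pos, Real.log_inv] at this
    linarith
  have hsR : Tendsto (fun j => (s j : ℝ)) atTop atTop := tendsto_natCast_atTop_atTop.comp hs
  have hv : Tendsto (fun j => (q j / s j * -Real.log 2) / (Real.log (κ / 4) / s j + Real.log ρ))
      atTop (𝓝 (β * c)) := by
    have h1 : Tendsto (fun j => (q j / s j * -Real.log 2) / (Real.log (κ / 4) / s j + Real.log ρ))
        atTop (𝓝 ((β * -Real.log 2) / (0 + Real.log ρ))) :=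
      (hq.mul_const _).div ((hsR.const_div_atTop _).add_const _) (by linarith)
    convert h1 using 2
    have := hlogρ.ne
    rw [hlog, zero_add]
    field_simp
  refine le_limsup_of_tendsto_seq hu hv ?_
  filter_upwards [hu.eventually hpos, hs.eventually_ge_atTop 1,
    hu.eventually (Ioo_mem_nhdsGT (zero_lt_one' ℝ))] with j hj hsj hr
  obtain ⟨I, hI, hgI⟩ := hg j
  -- With `κ / 4`, a ball has diameter at most `κ / 2 * ρ ^ s j`, below the separation of cylinders.
  set r := κ / 4 * ρ ^ s j with hrdef
  have hsj0 : (0 : ℝ) < s j := by exact_mod_cast hsj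
  have hlogr : Real.log r = Real.log (κ / 4) + s j * Real.log ρ := by
    rw [hrdef, Real.log_mul hκ4.ne' (pow_pos hπ.pos _).ne', Real.log_pow]
  have hlogr0 : Real.log r < 0 := Real.log_neg hr.1 hr.2
  have hball : ∀ x, ν (Metric.closedBall x r) ≤ 2⁻¹ ^ I.card := by
    intro x
    rw [hν, Measure.map_apply hmeas Metric.isClosed_closedBall.measurableSet]
    refine hπ.coinMeasure_preimage_le hgI (r := 2 * r) (Metric.ediam_le fun y hy z hz => ?_) ?_
    · rw [edist_dist]
      refine ENNReal.ofReal_le_ofReal ?_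
      have := dist_triangle_right y z x
      rw [Metric.mem_closedBall] at hy hz
      linarith
    · rw [hrdef]
      nlinarith [mul_pos hπ.sep_pos (pow_pos hπ.pos (s j))]
  have hint : (∫⁻ x, ν (Metric.closedBall x r) ∂ν).toReal ≤ 2⁻¹ ^ I.card := by
    have : ∫⁻ x, ν (Metric.closedBall x r) ∂ν ≤ 2⁻¹ ^ I.card := by
      calc ∫⁻ x, ν (Metric.closedBall x r) ∂ν ≤ ∫⁻ _, 2⁻¹ ^ I.card ∂ν := lintegral_mono hball
        _ = 2⁻¹ ^ I.card := by simp
    simpa using ENNReal.toReal_mono (by finiteness) this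
  have h3 := Real.log_le_log hj hint
  rw [Real.log_pow, Real.log_inv] at h3
  rw [EReal.coe_le_coe_iff]
  calc q j / s j * -Real.log 2 / (Real.log (κ / 4) / s j + Real.log ρ)
      = q j * -Real.log 2 / Real.log r := by
        rw [hlogr]
        have : Real.log (κ / 4) / s j + Real.log ρ =
          (Real.log (κ / 4) + s j * Real.log ρ) / s j := by field_simp
        rw [this, div_div_eq_mul_div]
        congr 1
        field_simp
    _ ≤ Real.log (∫⁻ x, ν (Metric.closedBall x r) ∂ν).toReal / Real.log r := by
        refine div_le_div_of_nonpos_of_le hlogr0.le (h3.trans ?_)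
        have := Real.log_pos one_lt_two
        nlinarith

end Correlation

/-! ### Packing dimension -/

lemma packingPremeasure_empty {X : Type*} [MetricSpace X] (s : ℝ) :
    packingPremeasure s (∅ : Set X) = 0 := by
  refine le_antisymm ((iInf₂_le 1 one_pos).trans ?_) bot_le
  refine iSup₂_le fun P hP => ?_
  have : P = ∅ := eq_empty_of_forall_notMem fun p hp => hP.center_mem p hp
  subst this
  simp

lemma packingMeasure_le_packingPremeasure {X : Type*} [MetricSpace X] (s : ℝ) (E : Set X) :
    packingMeasure s E ≤ packingPremeasure s E := by
  refine (iInf₂_le (fun i : ℕ => if i = 0 then E else ∅)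
    fun x hx => mem_iUnion.2 ⟨0, by simpa using hx⟩).trans ?_
  rw [tsum_eq_single 0 fun i hi => by simp [hi, packingPremeasure_empty]]
  simp

lemma ediam_closedBall_le_ofReal {X : Type*} [MetricSpace X] (x : X) (r : ℝ) :
    Metric.ediam (Metric.closedBall x r) ≤ ENNReal.ofReal (2 * r) := by
  refine Metric.ediam_le fun y hy z hz => ?_
  rw [edist_dist]
  refine ENNReal.ofReal_le_ofReal ?_
  have := dist_triangle_right y z x
  rw [Metric.mem_closedBall] at hy hz
  linarith

/-- The image of the coin measure gives a ball of radius `r` mass at least `r ^ c / 2`. Thus `|B| ^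
t` is at most a multiple of `δ ^ (t - c)` times its mass, and disjoint balls have total mass at most
`1`. -/
lemma packingPreDelta_le {X : Type*} [MetricSpace X] {ρ κ c : ℝ} {π : (ℕ → Bool) → X}
    (hπ : IsCantorCoding ρ κ π) (hρc : ρ ^ c = 2⁻¹) (hc : 0 < c) {E : Set X} (hE : E ⊆ range π)
    {t : ℝ} (ht : c < t) {δ : ℝ} (hδ : 0 < δ) (hδ1 : δ ≤ 1) :
    packingPreDelta t δ E ≤ ENNReal.ofReal (2 ^ (t + 1) * δ ^ (t - c)) := by
  borelize X
  refine iSup₂_le fun P hP => ?_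
  have := hP.countable.to_subtype
  set ν := coinMeasure.map π
  have hν : IsProbabilityMeasure ν :=
    Measure.isProbabilityMeasure_map hπ.continuous.measurable.aemeasurable
  have key : ∀ p : P, Metric.ediam (Metric.closedBall p.1.1 p.1.2) ^ t ≤
      ENNReal.ofReal (2 ^ (t + 1) * δ ^ (t - c)) * ν (Metric.closedBall p.1.1 p.1.2) := by
    rintro ⟨⟨z, r⟩, hp⟩
    obtain ⟨x, rfl⟩ := hE (hP.center_mem _ hp)
    have hr0 : 0 < r := hP.radius_pos _ hp
    have hrδ : r ≤ δ := hP.radius_le _ hp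
    obtain ⟨n, hn1, hn2⟩ := exists_nat_pow_near_of_lt_one hr0 (hrδ.trans hδ1) hπ.pos hπ.lt_one
    have h1 : ENNReal.ofReal (2⁻¹ * r ^ c) ≤ ν (Metric.closedBall (π x) r) := by
      calc ENNReal.ofReal (2⁻¹ * r ^ c) ≤ ENNReal.ofReal (2⁻¹ ^ (n + 1)) := by
            refine ENNReal.ofReal_le_ofReal ?_
            have h2 : (2⁻¹ : ℝ) ^ n = (ρ ^ n) ^ c := by
              have := half_rpow_eq hπ.pos hρc 1 n
              rwa [one_mul, one_mul, Real.rpow_natCast] at this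
            rw [pow_succ', h2]
            gcongr
        _ = 2⁻¹ ^ (n + 1) := by
            rw [ENNReal.ofReal_pow (by norm_num), ENNReal.ofReal_inv_of_pos (by norm_num)]
            norm_num
        _ ≤ ν (Metric.closedBall (π x) r) := by
            rw [Measure.map_apply hπ.continuous.measurable Metric.isClosed_closedBall.measurableSet]
            exact hπ.le_coinMeasure_preimage hn1.le x
    calc Metric.ediam (Metric.closedBall (π x) r) ^ t ≤ ENNReal.ofReal (2 * r) ^ t := by
          gcongr
          · linarith
          · exact ediam_closedBall_le_ofReal _ _
      _ = ENNReal.ofReal ((2 * r) ^ t) := ENNReal.ofReal_rpow_of_pos (by positivity)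
      _ ≤ ENNReal.ofReal (2 ^ (t + 1) * δ ^ (t - c) * (2⁻¹ * r ^ c)) := by
          refine ENNReal.ofReal_le_ofReal ?_
          have h3 : r ^ t = r ^ (t - c) * r ^ c := by
            rw [← Real.rpow_add hr0]; ring_nf
          have h4 : r ^ (t - c) ≤ δ ^ (t - c) :=
            Real.rpow_le_rpow hr0.le hrδ (by linarith)
          rw [Real.mul_rpow (by norm_num) hr0.le, h3, Real.rpow_add (by norm_num), Real.rpow_one]
          calc (2 : ℝ) ^ t * (r ^ (t - c) * r ^ c) ≤ 2 ^ t * (δ ^ (t - c) * r ^ c) := by gcongr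
            _ = _ := by ring
      _ = ENNReal.ofReal (2 ^ (t + 1) * δ ^ (t - c)) * ENNReal.ofReal (2⁻¹ * r ^ c) :=
          ENNReal.ofReal_mul (by positivity)
      _ ≤ _ := by gcongr
  calc ∑' p : P, Metric.ediam (Metric.closedBall p.1.1 p.1.2) ^ t
      ≤ ∑' p : P, ENNReal.ofReal (2 ^ (t + 1) * δ ^ (t - c)) *
          ν (Metric.closedBall p.1.1 p.1.2) := ENNReal.tsum_le_tsum key
    _ = ENNReal.ofReal (2 ^ (t + 1) * δ ^ (t - c)) *
          ν (⋃ p : P, Metric.closedBall p.1.1 p.1.2) := by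
        rw [ENNReal.tsum_mul_left, measure_iUnion]
        · exact fun p q hpq => hP.disjoint p.2 q.2 fun h => hpq (Subtype.ext h)
        · exact fun p => Metric.isClosed_closedBall.measurableSet
    _ ≤ ENNReal.ofReal (2 ^ (t + 1) * δ ^ (t - c)) * 1 := by gcongr; exact prob_le_one
    _ = _ := mul_one _

lemma packingDim_le {X : Type*} [MetricSpace X] {ρ κ c : ℝ} {π : (ℕ → Bool) → X}
    (hπ : IsCantorCoding ρ κ π) (hρc : ρ ^ c = 2⁻¹) (hc : 0 < c) {E : Set X} (hE : E ⊆ range π) :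
    packingDim E ≤ (c : EReal) := by
  refine EReal.le_of_forall_lt_iff_le.1 fun t ht => ?_
  rw [EReal.coe_lt_coe_iff] at ht
  refine iInf₂_le_of_le t (hc.le.trans ht.le) (iInf_le_of_le ?_ le_rfl)
  refine le_antisymm ((packingMeasure_le_packingPremeasure t E).trans ?_) bot_le
  have hlim : Tendsto (fun δ : ℝ => ENNReal.ofReal (2 ^ (t + 1) * δ ^ (t - c))) (𝓝[>] 0) (𝓝 0) := by
    have h1 : Tendsto (fun δ : ℝ => 2 ^ (t + 1) * δ ^ (t - c)) (𝓝[>] 0) (𝓝 0) := by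
      have h2 := (Real.continuousAt_rpow_const 0 (t - c) (Or.inr (by linarith))).tendsto
      rw [Real.zero_rpow (by linarith)] at h2
      simpa using (h2.mono_left nhdsWithin_le_nhds).const_mul ((2 : ℝ) ^ (t + 1))
    simpa using ENNReal.tendsto_ofReal h1
  refine ge_of_tendsto hlim ?_
  filter_upwards [Ioo_mem_nhdsGT (zero_lt_one' ℝ)] with δ hδ
  exact iInf₂_le_of_le δ hδ.1 (packingPreDelta_le hπ hρc hc hE ht hδ.1 hδ.2.le)

/-- Every piece of `K` contains, at infinitely many scales, a full binary tree in almost all of the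
levels up to that scale. -/
def HasFullScales (K : Set (ℕ → Bool)) : Prop :=
  ∀ x ∈ K, ∀ m n₀ : ℕ, ∀ θ < (1 : ℝ), ∃ n ≥ n₀, ∃ I : Finset ℕ, ∃ x' : ℕ → Bool,
    (∀ i ∈ I, m ≤ i ∧ i < n) ∧ θ * n ≤ I.card ∧ (∀ i < m, x' i = x i) ∧
      ∀ y : ℕ → Bool, (∀ i ∉ I, y i = x' i) → y ∈ K

/-! ### Lower bound for the packing dimension -/

variable {X : Type*} [NormedAddCommGroup X] [NormedSpace ℝ X] [Nontrivial X]
  {ρ κ c : ℝ} {π : (ℕ → Bool) → X}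

lemma le_packingPreDelta (hπ : IsCantorCoding ρ κ π) {I : Finset ℕ} {n : ℕ} (hI : ∀ i ∈ I, i < n)
    (x : ℕ → Bool) {S : Set X} (hS : ∀ y : ℕ → Bool, (∀ i ∉ I, y i = x i) → π y ∈ closure S)
    {s δ : ℝ} (hs : 0 ≤ s) (hδ : κ / 4 * ρ ^ n ≤ δ) :
    ENNReal.ofReal (2 ^ I.card * (κ / 4 * ρ ^ n) ^ s) ≤ packingPreDelta s δ S := by
  classical
  have h0 : 0 < κ * ρ ^ n := mul_pos hπ.sep_pos (pow_pos hπ.pos n)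
  set r := κ / 4 * ρ ^ n with hr
  have hr0 : 0 < r := by linarith
  let y : (I → Bool) → ℕ → Bool := fun v i => if h : i ∈ I then v ⟨i, h⟩ else x i
  -- Centres must lie in `S`, not its closure. Moving each by less than `κ * ρ ^ n / 8` leaves
  -- distances above `3 / 4 * κ * ρ ^ n`, more than `2 * r`.
  have hy : ∀ v, ∃ z ∈ S, dist (π (y v)) z < κ * ρ ^ n / 8 := fun v =>
    Metric.mem_closure_iff.1 (hS (y v) fun i hi => by simp [y, hi]) _ (by linarith)
  choose z hzS hz using hy
  have hsep : ∀ v w, v ≠ w → 2 * r < dist (z v) (z w) := by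
    intro v w hvw
    obtain ⟨i, hi⟩ := Function.ne_iff.1 hvw
    have h1 := hπ.le_dist (y v) (y w) n ⟨i, hI _ i.2, by simpa [y] using hi⟩
    have h2 := dist_triangle4 (π (y v)) (z v) (z w) (π (y w))
    have h3 := hz v
    have h4 := hz w
    rw [dist_comm] at h4
    linarith
  have hinj : Function.Injective fun v => (z v, r) := by
    intro v w hvw
    by_contra hne
    have h1 := hsep v w hne
    rw [show z v = z w from (Prod.ext_iff.1 hvw).1, dist_self] at h1
    linarith
  have hP : IsPacking δ S (range fun v => (z v, r)) := by
    refine ⟨countable_range _, ?_, ?_, ?_, ?_⟩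
    · rintro _ ⟨v, rfl⟩; exact hzS v
    · rintro _ ⟨v, rfl⟩; exact hr0
    · rintro _ ⟨v, rfl⟩; exact hδ
    · rintro _ ⟨v, rfl⟩ _ ⟨w, rfl⟩ hne
      refine Metric.closedBall_disjoint_closedBall ?_
      have := hsep v w fun h => hne (by rw [h])
      simp only
      linarith
  refine le_trans ?_ (le_iSup₂ (f := fun (P : Set (X × ℝ)) (_ : IsPacking δ S P) =>
    ∑' p : P, Metric.ediam (Metric.closedBall p.1.1 p.1.2) ^ s) _ hP)
  rw [tsum_range (fun p : X × ℝ => Metric.ediam (Metric.closedBall p.1 p.2) ^ s) hinj]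
  have hball : ∀ v, ENNReal.ofReal (r ^ s) ≤ Metric.ediam (Metric.closedBall (z v) r) ^ s := by
    intro v
    rw [← ENNReal.ofReal_rpow_of_pos hr0]
    gcongr
    -- In a nontrivial real normed space a ball of radius `r` has diameter `2 * r`; in a general
    -- metric space it could be a single point.
    have h1 := Metric.diam_closedBall_eq (z v) hr0.le
    rw [← ENNReal.ofReal_toReal (Metric.isBounded_closedBall (x := z v) (r := r)).ediam_ne_top]
    refine ENNReal.ofReal_le_ofReal ?_
    change r ≤ Metric.diam (Metric.closedBall (z v) r)
    linarith
  rw [tsum_fintype]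
  calc ENNReal.ofReal (2 ^ I.card * r ^ s) = ∑ _v : I → Bool, ENNReal.ofReal (r ^ s) := by
        rw [ENNReal.ofReal_mul (by positivity), ENNReal.ofReal_pow (by norm_num)]
        simp
    _ ≤ _ := Finset.sum_le_sum fun v _ => hball v

lemma packingPremeasure_eq_top (hπ : IsCantorCoding ρ κ π) (hρc : ρ ^ c = 2⁻¹) (hc : 0 < c)
    {K : Set (ℕ → Bool)} (hK : HasFullScales K) {x : ℕ → Bool} (hx : x ∈ K) {m : ℕ} {S : Set X}
    (hS : ∀ y ∈ K, (∀ i < m, y i = x i) → π y ∈ closure S) {s : ℝ} (hs : 0 ≤ s) (hsc : s < c) :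
    packingPremeasure s S = ⊤ := by
  refine iInf₂_eq_top.2 fun δ hδ => ?_
  have hsc1 : s / c < 1 := (div_lt_one hc).2 hsc
  -- Density `s / c + η < 1` leaves a surplus: `2 ^ I.card * ρ ^ (n * s)` is at least `2 ^ (η * n)`,
  -- which is unbounded.
  set η := (1 - s / c) / 2 with hη
  have hη0 : 0 < η := by linarith
  have hκ4 : 0 < κ / 4 := by linarith [hπ.sep_pos]
  have hlim : Tendsto (fun n : ℕ => ENNReal.ofReal ((κ / 4) ^ s * (2 ^ η) ^ n)) atTop (𝓝 ⊤) := by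
    refine ENNReal.tendsto_ofReal_atTop.comp ?_
    exact (tendsto_pow_atTop_atTop_of_one_lt (Real.one_lt_rpow one_lt_two hη0)).const_mul_atTop
      (Real.rpow_pos_of_pos hκ4 s)
  have hsmall := (tendsto_mul_pow_nhdsGT_zero hπ.pos hπ.lt_one hκ4 tendsto_id).eventually
    (Ioo_mem_nhdsGT hδ)
  refine ENNReal.eq_top_of_forall_nnreal_le fun M => ?_
  obtain ⟨n₀, hn₀⟩ := eventually_atTop.1 (hsmall.and (hlim.eventually
    (eventually_ge_nhds (ENNReal.coe_lt_top (r := M)))))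
  obtain ⟨n, hn, I, x', hI, hcard, hx', hfull⟩ := hK x hx m n₀ (s / c + η) (by linarith)
  obtain ⟨hδn, hM⟩ := hn₀ n hn
  refine le_trans hM (le_trans ?_ (le_packingPreDelta hπ (fun i hi => (hI i hi).2) x'
    (fun y hy => hS y (hfull y hy) fun i hi => ?_) hs hδn.2.le))
  · refine ENNReal.ofReal_le_ofReal ?_
    have hρ := pow_pos hπ.pos n
    rw [Real.mul_rpow hκ4.le hρ.le, mul_left_comm]
    gcongr
    have h1 : (ρ ^ n) ^ s = (2⁻¹ : ℝ) ^ (s / c * n) := by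
      rw [half_rpow_eq hπ.pos hρc, div_mul_cancel₀ _ hc.ne']
    rw [h1, ← Real.rpow_natCast, ← Real.rpow_natCast, ← Real.rpow_mul two_pos.le,
      Real.inv_rpow two_pos.le, ← Real.rpow_neg two_pos.le, ← Real.rpow_add two_pos]
    exact Real.rpow_le_rpow_of_exponent_le one_le_two (by linarith)
  · rw [hy i fun h => ?_, hx' i hi]
    exact absurd (hI i h).1 (by omega)

lemma exists_cylinder_subset_of_subset_iUnion {K : Set (ℕ → Bool)} (hK : IsClosed K)
    (hne : K.Nonempty) {C : ℕ → Set (ℕ → Bool)} (hC : ∀ i, IsClosed (C i)) (hKC : K ⊆ ⋃ i, C i) :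
    ∃ i, ∃ x ∈ K, ∃ m, ∀ y ∈ K, (∀ k < m, y k = x k) → y ∈ C i := by
  have : CompactSpace K := isCompact_iff_compactSpace.1 hK.isCompact
  have : Nonempty K := hne.to_subtype
  obtain ⟨i, x, hx⟩ := nonempty_interior_of_iUnion_of_closed (X := K)
    (f := fun i => Subtype.val ⁻¹' C i) (fun i => (hC i).preimage continuous_subtype_val) (by
      rw [← preimage_iUnion]
      exact eq_univ_of_forall fun x => hKC x.2)
  obtain ⟨U, hU, hUi⟩ := isOpen_induced_iff.1 (isOpen_interior (s := Subtype.val ⁻¹' C i))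
  have hxU : (x : ℕ → Bool) ∈ U := by
    rw [← hUi] at hx; exact hx
  obtain ⟨_, ⟨z, m, rfl⟩, hxz, hzU⟩ :=
    (PiNat.isTopologicalBasis_cylinders fun _ : ℕ => Bool).exists_subset_of_mem_open hxU hU
  refine ⟨i, x, x.2, m, fun y hy hyx => ?_⟩
  have hyU : (⟨y, hy⟩ : K) ∈ Subtype.val ⁻¹' U := hzU fun k hk => (hyx k hk).trans (hxz k hk)
  rw [hUi] at hyU
  exact interior_subset (s := Subtype.val ⁻¹' C i) hyU

/-- By Baire, in any countable cover some piece is dense in the image of a cylinder of `K`, and full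
scales there make its premeasure infinite. -/
lemma le_packingDim (hπ : IsCantorCoding ρ κ π) (hρc : ρ ^ c = 2⁻¹) (hc : 0 < c)
    {K : Set (ℕ → Bool)} (hK : HasFullScales K) (hKc : IsClosed K) (hne : K.Nonempty)
    {E : Set X} (hE : π '' K ⊆ E) : (c : EReal) ≤ packingDim E := by
  refine le_iInf₂ fun s hs => le_iInf fun h => ?_
  by_contra! hlt
  rw [EReal.coe_lt_coe_iff] at hlt
  have htop : packingMeasure s E = ⊤ := by
    refine iInf₂_eq_top.2 fun F hF => ?_
    obtain ⟨i, x, hx, m, hm⟩ := exists_cylinder_subset_of_subset_iUnion hKc hne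
      (C := fun i => π ⁻¹' closure (F i)) (fun i => isClosed_closure.preimage hπ.continuous) (by
        rw [← preimage_iUnion, ← image_subset_iff]
        exact (hE.trans hF).trans (iUnion_mono fun i => subset_closure))
    exact ENNReal.tsum_eq_top_of_eq_top ⟨i, packingPremeasure_eq_top hπ hρc hc hK hx hm hs hlt⟩
  rw [h] at htop
  exact ENNReal.zero_ne_top htop

/-! ### Factorial windows -/

open Nat in
/-- The `j`-th window of levels. -/
def window (j : ℕ) : Finset ℕ := Finset.Ico (2 * j + 1)! (2 * j + 2)!

open Nat in
lemma eq_of_mem_window {i j k : ℕ} (h1 : (2 * j)! ≤ i) (h2 : i < (2 * j + 3)!)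
    (hk : i ∈ window k) : k = j := by
  rw [window, Finset.mem_Ico] at hk
  by_contra hne
  rcases Nat.lt_or_gt_of_ne hne with h | h
  · have := Nat.factorial_le (show 2 * k + 2 ≤ 2 * j by omega)
    omega
  · have := Nat.factorial_le (show 2 * j + 3 ≤ 2 * k + 1 by omega)
    omega

open Nat in
lemma notMem_window {i j : ℕ} (h1 : (2 * j)! ≤ i) (h2 : i < (2 * j + 1)!) (k : ℕ) :
    i ∉ window k := by
  intro hk
  have := Nat.factorial_le (show 2 * j + 1 ≤ 2 * j + 3 by omega)
  obtain rfl := eq_of_mem_window h1 (h2.trans_le this) hk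
  rw [window, Finset.mem_Ico] at hk
  omega

open Nat in
lemma le_of_mem_window {i k : ℕ} (hk : i ∈ window k) : k ≤ i := by
  rw [window, Finset.mem_Ico] at hk
  have := Nat.self_le_factorial (2 * k + 1)
  omega

open Nat in
lemma exists_window_scale {n j₀ : ℕ} (hn : (2 * j₀ + 1)! ≤ n) :
    ∃ j ≥ j₀, (2 * j + 1)! ≤ n ∧ n < (2 * j + 3)! := by
  have hex : ∃ j, n < (2 * j + 3)! :=
    ⟨n, by have := Nat.self_le_factorial (2 * n + 3); omega⟩
  have hj := Nat.find_spec hex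
  have hmin : ∀ k < Nat.find hex, (2 * k + 3)! ≤ n := fun k hk => not_lt.1 (Nat.find_min hex hk)
  generalize Nat.find hex = j at hj hmin
  have hjj : j₀ ≤ j := by
    by_contra! hlt
    have := Nat.factorial_le (show 2 * j + 3 ≤ 2 * j₀ + 1 by omega)
    omega
  refine ⟨j, hjj, ?_, hj⟩
  rcases Nat.eq_zero_or_pos j with rfl | hpos
  · exact (Nat.factorial_le (by omega)).trans hn
  · have := hmin (j - 1) (by omega)
    rwa [show 2 * (j - 1) + 3 = 2 * j + 1 by omega] at this

lemma tendsto_two_mul_add_atTop (k : ℕ) : Tendsto (fun j : ℕ => 2 * j + k) atTop atTop :=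
  tendsto_atTop_mono (fun j => show j ≤ 2 * j + k by omega) tendsto_id

open Nat in
lemma tendsto_factorial_two_mul_add_atTop (k : ℕ) :
    Tendsto (fun j : ℕ => (2 * j + k)!) atTop atTop :=
  tendsto_atTop_mono (fun _ => Nat.self_le_factorial _) (tendsto_two_mul_add_atTop k)

open Nat in
-- Each window endpoint is negligible against the next, so the density up to an endpoint is that of
-- the last block.
lemma tendsto_factorial_div_factorial_succ (k : ℕ) :
    Tendsto (fun j : ℕ => ((2 * j + k)! : ℝ) / (2 * j + k + 1)!) atTop (𝓝 0) := by
  have h : Tendsto (fun j : ℕ => (1 : ℝ) / ((2 * j + (k + 1) : ℕ) : ℝ)) atTop (𝓝 0) :=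
    (tendsto_natCast_atTop_atTop.comp (tendsto_two_mul_add_atTop (k + 1))).const_div_atTop 1
  refine h.congr fun j => ?_
  have : ((2 * j + k)! : ℝ) ≠ 0 := by positivity
  rw [Nat.factorial_succ]
  push_cast
  field_simp
  ring

/-! ### The homogeneous set -/

section Homogeneous

variable (α β : ℝ)

open Classical in
/-- The target density of free levels near level `m`: `β` inside and `α` outside the windows. -/
noncomputable def levelDensity (m : ℕ) : ℝ := if ∃ j, m ∈ window j then β else α

/-- The target number of free levels below level `n`. -/
noncomputable def cumulativeDensity (n : ℕ) : ℝ := ∑ m ∈ Finset.range n, levelDensity α β m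

/-- The set of free levels. -/
def freeLevels : Set ℕ := {n | ⌊cumulativeDensity α β n⌋₊ < ⌊cumulativeDensity α β (n + 1)⌋₊}

/-- Sequences that vanish off the free levels. -/
def homogeneousSet : Set (ℕ → Bool) := {x | ∀ n, x n = true → n ∈ freeLevels α β}

open Classical in
/-- The free levels below `n`. -/
noncomputable def freeLevelsBelow (n : ℕ) : Finset ℕ := {m ∈ Finset.range n | m ∈ freeLevels α β}

open Classical in
/-- Setting a sequence to zero off the free levels. -/
noncomputable def freeMask (x : ℕ → Bool) : ℕ → Bool := fun n => x n && decide (n ∈ freeLevels α β)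

variable {α β}

lemma levelDensity_mem_Icc (h : α ≤ β) (m : ℕ) : levelDensity α β m ∈ Icc α β := by
  unfold levelDensity
  split_ifs
  · exact ⟨h, le_rfl⟩
  · exact ⟨le_rfl, h⟩

lemma le_cumulativeDensity (h : α ≤ β) (n : ℕ) : α * n ≤ cumulativeDensity α β n := by
  have := Finset.card_nsmul_le_sum (Finset.range n) (levelDensity α β) α
    fun m _ => (levelDensity_mem_Icc h m).1
  simpa [cumulativeDensity, mul_comm] using this

lemma cumulativeDensity_le (h : α ≤ β) (n : ℕ) : cumulativeDensity α β n ≤ β * n := by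
  have := Finset.sum_le_card_nsmul (Finset.range n) (levelDensity α β) β
    fun m _ => (levelDensity_mem_Icc h m).2
  simpa [cumulativeDensity, mul_comm] using this

lemma cumulativeDensity_nonneg (h0 : 0 ≤ α) (h : α ≤ β) (n : ℕ) :
    0 ≤ cumulativeDensity α β n :=
  (mul_nonneg h0 n.cast_nonneg).trans (le_cumulativeDensity h n)

open Nat in
lemma cumulativeDensity_window_start_le (h0 : 0 ≤ α) (h : α ≤ β) (h1 : β ≤ 1) (j : ℕ) :
    cumulativeDensity α β (2 * j + 1)! ≤ α * (2 * j + 1)! + (2 * j)! := by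
  have hle : (2 * j)! ≤ (2 * j + 1)! := Nat.factorial_le (by omega)
  rw [cumulativeDensity, ← Finset.sum_range_add_sum_Ico _ hle]
  have hA : ∑ m ∈ Finset.range (2 * j)!, levelDensity α β m ≤ (2 * j)! := by
    have := cumulativeDensity_le h (2 * j)!
    refine this.trans ?_
    have : (0 : ℝ) ≤ (2 * j)! := by positivity
    nlinarith
  have hB : ∑ m ∈ Finset.Ico (2 * j)! (2 * j + 1)!, levelDensity α β m ≤ α * (2 * j + 1)! := by
    calc _ = ∑ m ∈ Finset.Ico (2 * j)! (2 * j + 1)!, α := by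
          refine Finset.sum_congr rfl fun m hm => ?_
          rw [Finset.mem_Ico] at hm
          exact if_neg fun ⟨k, hk⟩ => notMem_window hm.1 hm.2 k hk
      _ = ((2 * j + 1)! - (2 * j)! : ℝ) * α := by
          rw [Finset.sum_const, Nat.card_Ico, nsmul_eq_mul, Nat.cast_sub hle]
      _ ≤ _ := by
          have : (0 : ℝ) ≤ (2 * j)! := by positivity
          nlinarith
  linarith

open Nat in
lemma le_cumulativeDensity_window_end (h0 : 0 ≤ α) (h : α ≤ β) (j : ℕ) :
    β * ((2 * j + 2)! - (2 * j + 1)!) ≤ cumulativeDensity α β (2 * j + 2)! := by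
  have hle : (2 * j + 1)! ≤ (2 * j + 2)! := Nat.factorial_le (by omega)
  rw [cumulativeDensity, ← Finset.sum_range_add_sum_Ico _ hle]
  have hA : 0 ≤ ∑ m ∈ Finset.range (2 * j + 1)!, levelDensity α β m :=
    cumulativeDensity_nonneg h0 h _
  have hB : ∑ m ∈ Finset.Ico (2 * j + 1)! (2 * j + 2)!, levelDensity α β m =
      β * ((2 * j + 2)! - (2 * j + 1)!) := by
    calc _ = ∑ m ∈ Finset.Ico (2 * j + 1)! (2 * j + 2)!, β :=
          Finset.sum_congr rfl fun m hm => if_pos ⟨j, hm⟩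
      _ = _ := by
          rw [Finset.sum_const, Nat.card_Ico, nsmul_eq_mul, Nat.cast_sub hle, mul_comm]
  linarith

/-- As `β ≤ 1`, the cumulative density grows by at most `1` per level, so its floor jumps by exactly
one at each free level and is constant elsewhere. -/
lemma card_freeLevelsBelow (h0 : 0 ≤ α) (h : α ≤ β) (h1 : β ≤ 1) (n : ℕ) :
    (freeLevelsBelow α β n).card = ⌊cumulativeDensity α β n⌋₊ := by
  classical
  induction n with
  | zero => simp [freeLevelsBelow, cumulativeDensity]
  | succ n ih =>
    have hs : cumulativeDensity α β (n + 1) =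
        cumulativeDensity α β n + levelDensity α β n := Finset.sum_range_succ _ _
    obtain ⟨hl, hu⟩ := levelDensity_mem_Icc h n
    have hmono : ⌊cumulativeDensity α β n⌋₊ ≤ ⌊cumulativeDensity α β (n + 1)⌋₊ :=
      Nat.floor_mono (by linarith)
    have hle : ⌊cumulativeDensity α β (n + 1)⌋₊ ≤ ⌊cumulativeDensity α β n⌋₊ + 1 := by
      rw [← Nat.floor_add_one (cumulativeDensity_nonneg h0 h n)]
      exact Nat.floor_mono (by linarith)
    rw [freeLevelsBelow, Finset.range_add_one, Finset.filter_insert]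
    rw [freeLevelsBelow] at ih
    split_ifs with hn
    · rw [Finset.card_insert_of_notMem (by simp), ih]
      have : ⌊cumulativeDensity α β n⌋₊ < ⌊cumulativeDensity α β (n + 1)⌋₊ := hn
      omega
    · rw [ih]
      have : ¬⌊cumulativeDensity α β n⌋₊ < ⌊cumulativeDensity α β (n + 1)⌋₊ := hn
      omega

lemma card_freeLevelsBelow_le (h0 : 0 ≤ α) (h : α ≤ β) (h1 : β ≤ 1) (n : ℕ) :
    ((freeLevelsBelow α β n).card : ℝ) ≤ cumulativeDensity α β n := by
  rw [card_freeLevelsBelow h0 h h1]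
  exact Nat.floor_le (cumulativeDensity_nonneg h0 h n)

lemma le_card_freeLevelsBelow (h0 : 0 ≤ α) (h : α ≤ β) (h1 : β ≤ 1) (n : ℕ) :
    cumulativeDensity α β n - 1 ≤ (freeLevelsBelow α β n).card := by
  rw [card_freeLevelsBelow h0 h h1]
  exact (Nat.sub_one_lt_floor _).le

lemma isClosed_homogeneousSet : IsClosed (homogeneousSet α β) := by
  rw [homogeneousSet, ofPred_forall]
  exact isClosed_iInter fun n => IsClosed.preimage (f := fun x : ℕ → Bool => x n)
    (continuous_apply n) (isClosed_discrete {b : Bool | b = true → n ∈ freeLevels α β})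

lemma determines_homogeneousSet (n : ℕ) :
    Determines (freeLevelsBelow α β n) n (homogeneousSet α β) := by
  intro x hx y hy hxy i hi
  by_cases hf : i ∈ freeLevels α β
  · exact hxy i (by simp [freeLevelsBelow, hi, hf])
  · rw [Bool.eq_false_iff.2 fun h => hf (hx i h), Bool.eq_false_iff.2 fun h => hf (hy i h)]

lemma freeMask_mem (x : ℕ → Bool) : freeMask α β x ∈ homogeneousSet α β := by
  intro n hn
  simp only [freeMask, Bool.and_eq_true, decide_eq_true_eq] at hn
  exact hn.2

lemma measurable_freeMask : Measurable (freeMask α β) := by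
  classical
  exact measurable_pi_iff.2 fun n =>
    (Measurable.of_discrete (f := fun b : Bool => b && decide (n ∈ freeLevels α β))).comp
      (measurable_pi_apply n)

lemma eq_of_freeMask_eq {n : ℕ} {x y : ℕ → Bool}
    (h : ∀ i < n, freeMask α β x i = freeMask α β y i) :
    ∀ i ∈ freeLevelsBelow α β n, x i = y i := by
  intro i hi
  simp only [freeLevelsBelow, Finset.mem_filter, Finset.mem_range] at hi
  simpa [freeMask, hi.2] using h i hi.1

end Homogeneous

/-! ### The set with exclusive windows -/

/-- Sequences that vanish off those windows `j` for which they start with the first `j` terms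
of `z j`. -/
def exclusiveSet (z : ℕ → ℕ → Bool) : Set (ℕ → Bool) :=
  {x | ∀ n, x n = true → ∃ j, n ∈ window j ∧ ∀ i < j, x i = z j i}

section Exclusive

variable {z : ℕ → ℕ → Bool}

/-- A violation at level `n` is visible in the first `n + 1` coordinates, since a window containing
`n` has index at most `n`. -/
lemma isClosed_exclusiveSet : IsClosed (exclusiveSet z) := by
  rw [← isOpen_compl_iff, isOpen_iff_mem_nhds]
  intro x hx
  simp only [exclusiveSet, mem_compl_iff, mem_ofPred_eq, not_forall, not_exists, not_and] at hx
  obtain ⟨n, hn, hj⟩ := hx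
  filter_upwards [(PiNat.isOpen_cylinder (fun _ : ℕ => Bool) x (n + 1)).mem_nhds
    (PiNat.self_mem_cylinder x _)] with y hy hyE
  rw [PiNat.mem_cylinder_iff] at hy
  obtain ⟨j, hnj, h⟩ := hyE n (by rw [hy n n.lt_succ_self, hn])
  obtain ⟨i, hi, hne⟩ := hj j hnj
  have := le_of_mem_window hnj
  exact hne (by rw [← hy i (by omega), h i hi])

open Nat in
lemma determines_exclusiveSet (j : ℕ) :
    Determines (Finset.range (2 * j)!) (2 * j + 1)! (exclusiveSet z) := by
  intro x hx y hy hxy i hi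
  rcases lt_or_ge i (2 * j)! with h | h
  · exact hxy i (Finset.mem_range.2 h)
  · have hfalse : ∀ w ∈ exclusiveSet z, w i = false := fun w hw => by
      rw [Bool.eq_false_iff]
      intro hwi
      obtain ⟨k, hk, -⟩ := hw i hwi
      exact notMem_window h hi k hk
    rw [hfalse x hx, hfalse y hy]

open Nat in
-- Removing the cylinder closes window `j`, merging the gaps on both sides into one block of zeros
-- from `(2 * j)!` to `(2 * j + 3)!`.
lemma determines_exclusiveSet_diff_cylinder {j n : ℕ} (hn : n ≤ (2 * j + 3)!) :
    Determines (Finset.range (2 * j)!) n (exclusiveSet z \ PiNat.cylinder (z j) j) := by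
  intro x hx y hy hxy i hi
  rcases lt_or_ge i (2 * j)! with h | h
  · exact hxy i (Finset.mem_range.2 h)
  · have hfalse : ∀ w ∈ exclusiveSet z \ PiNat.cylinder (z j) j, w i = false := fun w hw => by
      rw [Bool.eq_false_iff]
      intro hwi
      obtain ⟨k, hk, hwk⟩ := hw.1 i hwi
      obtain rfl := eq_of_mem_window h (hi.trans_le hn) hk
      exact hw.2 hwk
    rw [hfalse x hx, hfalse y hy]

lemma zero_mem_exclusiveSet : (fun _ => false) ∈ exclusiveSet z := by
  intro n hn
  simp at hn

open Nat in
-- Truncate `x` at `m` and choose a late `j` for which `z j` is this truncation: window `j` is then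
-- free, and it fills almost all levels below its end.
lemma hasFullScales_exclusiveSet
    (hz : ∀ (S : Finset ℕ) (N : ℕ), ∃ j ≥ N, z j = fun i => decide (i ∈ S)) :
    HasFullScales (exclusiveSet z) := by
  intro x hx m n₀ θ hθ
  have hev := (tendsto_factorial_div_factorial_succ 1).eventually
    (eventually_le_nhds (show (0 : ℝ) < 1 - θ by linarith))
  obtain ⟨J, hJ⟩ := eventually_atTop.1 hev
  obtain ⟨j, hj, hzj⟩ := hz {i ∈ Finset.range m | x i = true} (max J (max m n₀))
  have hJj := hJ j (by omega)
  have hs := Nat.self_le_factorial (2 * j + 1)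
  have ht := Nat.self_le_factorial (2 * j + 2)
  have hle : (2 * j + 1)! ≤ (2 * j + 2)! := Nat.factorial_le (by omega)
  have hx' : ∀ i, z j i = true ↔ i < m ∧ x i = true := by simp [hzj]
  have hzx : ∀ i < m, z j i = x i := fun i hi => by rw [Bool.eq_iff_iff, hx']; simp [hi]
  refine ⟨(2 * j + 2)!, by omega, window j, z j, fun i hi => ?_, ?_, hzx, ?_⟩
  · rw [window, Finset.mem_Ico] at hi
    omega
  · rw [window, Nat.card_Ico, Nat.cast_sub hle]
    rw [div_le_iff₀ (by positivity)] at hJj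
    linarith
  · intro y hy n hn
    have hyz : ∀ i < j, y i = z j i := fun i hi => by
      refine hy i fun hw => ?_
      rw [window, Finset.mem_Ico] at hw
      omega
    by_cases hnw : n ∈ window j
    · exact ⟨j, hnw, hyz⟩
    · rw [hy n hnw, hx'] at hn
      obtain ⟨k, hk, hxk⟩ := hx n hn.2
      have := le_of_mem_window hk
      -- Here `k ≤ n < m ≤ j`, so the permission that `x` has for window `k` passes to `y`.
      refine ⟨k, hk, fun i hi => ?_⟩
      rw [hyz i (by omega), hzx i (by omega), hxk i hi]

end Exclusive

lemma exists_seq_frequently_finset :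
    ∃ z : ℕ → ℕ → Bool, ∀ (S : Finset ℕ) (N : ℕ), ∃ j ≥ N, z j = fun i => decide (i ∈ S) := by
  obtain ⟨g, hg⟩ := exists_surjective_nat (Finset ℕ)
  refine ⟨fun j i => decide (i ∈ g (Nat.unpair j).1), fun S N => ?_⟩
  obtain ⟨k, rfl⟩ := hg S
  exact ⟨Nat.pair k N, Nat.right_le_pair k N, by simp⟩

/-! ### Dimensions of the union -/

section Union

variable {X : Type*} [MetricSpace X] {ρ κ c : ℝ} {π : (ℕ → Bool) → X} {α β : ℝ}
  {z : ℕ → ℕ → Bool}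

open Nat in
lemma tendsto_window_start_ratio (α : ℝ) :
    Tendsto (fun j : ℕ => (α * (2 * j + 1)! + (2 * j)!) / ((2 * j + 1)! : ℝ)) atTop (𝓝 α) := by
  have h := (tendsto_factorial_div_factorial_succ 0).const_add α
  rw [add_zero] at h
  refine h.congr fun j => ?_
  have : ((2 * j + 1)! : ℝ) ≠ 0 := by positivity
  rw [add_div, mul_div_cancel_right₀ _ this]
  simp

open Nat in
lemma tendsto_window_end_ratio (β : ℝ) :
    Tendsto (fun j : ℕ => (β * ((2 * j + 2)! - (2 * j + 1)!) - 1) / ((2 * j + 2)! : ℝ))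
      atTop (𝓝 β) := by
  have h1 := ((tendsto_factorial_div_factorial_succ 1).const_sub 1).const_mul β
  have h2 : Tendsto (fun j : ℕ => (1 : ℝ) / ((2 * j + 2)! : ℕ)) atTop (𝓝 0) :=
    (tendsto_natCast_atTop_atTop.comp (tendsto_factorial_two_mul_add_atTop 2)).const_div_atTop 1
  have h := h1.sub h2
  rw [sub_zero, sub_zero, mul_one] at h
  refine h.congr fun j => ?_
  have : ((2 * j + 2)! : ℝ) ≠ 0 := by positivity
  field_simp

open Nat in
lemma lowerBoxDim_homogeneousSet_le (hπ : IsCantorCoding ρ κ π) (hρc : ρ ^ c = 2⁻¹) (h0 : 0 ≤ α)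
    (h : α ≤ β) (h1 : β ≤ 1) :
    lowerBoxDim (π '' homogeneousSet α β) ≤ ((α * c : ℝ) : EReal) :=
  lowerBoxDim_image_le hπ hρc (tendsto_factorial_two_mul_add_atTop 1)
    (tendsto_window_start_ratio α) fun j => ⟨_, determines_homogeneousSet _,
      (card_freeLevelsBelow_le h0 h h1 _).trans (cumulativeDensity_window_start_le h0 h h1 j)⟩

open Nat in
-- The count `(2 * j)!` is `o((2 * j + 1)!)`; the weaker ratio `α` suffices.
lemma lowerBoxDim_exclusiveSet_le (hπ : IsCantorCoding ρ κ π) (hρc : ρ ^ c = 2⁻¹) (h0 : 0 ≤ α) :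
    lowerBoxDim (π '' exclusiveSet z) ≤ ((α * c : ℝ) : EReal) :=
  lowerBoxDim_image_le hπ hρc (tendsto_factorial_two_mul_add_atTop 1)
    (tendsto_window_start_ratio α) fun j => ⟨_, determines_exclusiveSet _, by
      rw [Finset.card_range]
      have : 0 ≤ α * (2 * j + 1)! := by positivity
      linarith⟩

lemma modifiedLowerBoxDim_union_le (hπ : IsCantorCoding ρ κ π) (hρc : ρ ^ c = 2⁻¹) (h0 : 0 ≤ α)
    (h : α ≤ β) (h1 : β ≤ 1) :
    modifiedLowerBoxDim (π '' homogeneousSet α β ∪ π '' exclusiveSet z) ≤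
      ((α * c : ℝ) : EReal) := by
  refine iInf₂_le_of_le
    (fun i : ℕ => if i = 0 then π '' homogeneousSet α β else π '' exclusiveSet z) (fun i => ?_)
    (iInf_le_of_le ?_ (iSup_le fun i => ?_))
  · dsimp only
    split_ifs
    · exact isClosed_homogeneousSet.isCompact.image hπ.continuous
    · exact isClosed_exclusiveSet.isCompact.image hπ.continuous
  · refine union_subset (fun x hx => mem_iUnion.2 ⟨0, ?_⟩) fun x hx => mem_iUnion.2 ⟨1, ?_⟩
    · simpa using hx
    · simpa using hx
  · dsimp only
    split_ifs
    · exact lowerBoxDim_homogeneousSet_le hπ hρc h0 h h1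
    · exact lowerBoxDim_exclusiveSet_le hπ hρc h0

/-- In any countable compact cover, some piece has positive mass for the coin measure masked to the
free levels, and the mass bound applies to it. -/
lemma le_modifiedLowerBoxDim (hπ : IsCantorCoding ρ κ π) (hρc : ρ ^ c = 2⁻¹) (hc : 0 < c)
    (h0 : 0 ≤ α) (h : α ≤ β) (h1 : β ≤ 1) {E : Set X} (hE : π '' homogeneousSet α β ⊆ E) :
    ((α * c : ℝ) : EReal) ≤ modifiedLowerBoxDim E := by
  refine le_iInf₂ fun F hF => le_iInf fun hEF => ?_
  have hcov : ⋃ i, (fun x => π (freeMask α β x)) ⁻¹' F i = univ := by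
    rw [← preimage_iUnion]
    exact eq_univ_of_forall fun x => hEF (hE ⟨_, freeMask_mem x, rfl⟩)
  have hne : ∃ i, coinMeasure ((fun x => π (freeMask α β x)) ⁻¹' F i) ≠ 0 := by
    by_contra! hall
    have := measure_iUnion_null hall
    rw [hcov, measure_univ] at this
    exact one_ne_zero this
  obtain ⟨i, hi⟩ := hne
  refine le_iSup_of_le i (le_lowerBoxDim_of_coinMeasure_ne_zero hπ hρc hc h0 (fun n => ?_) (hF i) hi)
  refine ⟨freeLevelsBelow α β n, ?_, fun x y => eq_of_freeMask_eq⟩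
  have := le_card_freeLevelsBelow h0 h h1 n
  have := le_cumulativeDensity h n
  linarith

/-- The support contains two points, and a set of diameter at most a quarter of their distance
cannot meet the small balls about both. -/
lemma exists_le_measure_disjoint_of_nonatomic [MeasurableSpace X]
    [SecondCountableTopology X] (μ : Measure X)
    [IsProbabilityMeasure μ] (hμ : ∀ x, μ {x} = 0) :
    ∃ (ε : ℝ) (δ : ENNReal), 0 < ε ∧ δ ≠ 0 ∧ ∀ S : Set X, Metric.ediam S ≤ ENNReal.ofReal ε →
      ∃ B : Set X, δ ≤ μ B ∧ Disjoint B S := by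
  have hsupp : μ.support.Nontrivial := by
    rw [← not_subsingleton_iff]
    intro hsub
    have h1 : μ μ.support = 0 := by
      rcases hsub.eq_empty_or_singleton with h | ⟨x, h⟩
      · rw [h, measure_empty]
      · rw [h, hμ]
    have h2 := measure_union_null h1 (Measure.measure_compl_support (μ := μ))
    rw [union_compl_self, measure_univ] at h2
    exact one_ne_zero h2
  obtain ⟨x, hx, y, hy, hxy⟩ := hsupp
  have hd : 0 < dist x y := dist_pos.2 hxy
  set ε := dist x y / 4 with hε
  have hε0 : 0 < ε := by linarith
  rw [Measure.mem_support_iff_forall] at hx hy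
  have hxp := hx _ (Metric.ball_mem_nhds x hε0)
  have hyp := hy _ (Metric.ball_mem_nhds y hε0)
  refine ⟨ε, min (μ (Metric.ball x ε)) (μ (Metric.ball y ε)), hε0, (lt_min hxp hyp).ne',
    fun S hS => ?_⟩
  by_cases hSx : Disjoint (Metric.ball x ε) S
  · exact ⟨_, min_le_left _ _, hSx⟩
  refine ⟨_, min_le_right _ _, ?_⟩
  obtain ⟨u, hux, huS⟩ := not_disjoint_iff.1 hSx
  rw [Set.disjoint_left]
  intro v hvy hvS
  have h1 := (Metric.edist_le_ediam_of_mem huS hvS).trans hS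
  rw [edist_dist, ENNReal.ofReal_le_ofReal_iff hε0.le] at h1
  have h2 := dist_triangle4 x u v y
  rw [Metric.mem_ball] at hux hvy
  rw [dist_comm] at hux
  linarith

variable [MeasurableSpace X] [BorelSpace X]

lemma le_upperCorrDim (hπ : IsCantorCoding ρ κ π) (hρc : ρ ^ c = 2⁻¹) (hc : 0 < c)
    (h0 : 0 ≤ α) (h : α ≤ β) (h1 : β ≤ 1) {E : Set X} (hE : π '' homogeneousSet α β ⊆ E) :
    ((β * c : ℝ) : EReal) ≤ upperCorrDim E := by
  have hmeas : Measurable fun x => π (freeMask α β x) :=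
    hπ.continuous.measurable.comp measurable_freeMask
  set ν := coinMeasure.map fun x => π (freeMask α β x) with hν
  have hprob : IsProbabilityMeasure ν := Measure.isProbabilityMeasure_map hmeas.aemeasurable
  have hA : MeasurableSet (π '' homogeneousSet α β) :=
    (isClosed_homogeneousSet.isCompact.image hπ.continuous).measurableSet
  have hνA : ν (π '' homogeneousSet α β) = 1 := by
    rw [hν, Measure.map_apply hmeas hA, ← measure_univ (μ := coinMeasure)]
    congr 1
    exact eq_univ_of_forall fun x => ⟨_, freeMask_mem x, rfl⟩
  have hνE : ν Eᶜ = 0 :=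
    measure_mono_null (compl_subset_compl.2 hE) ((prob_compl_eq_zero_iff hA).2 hνA)
  have hβ0 : 0 ≤ β := h0.trans h
  refine le_iSup_of_le ν (le_iSup₂_of_le hprob hνE ?_)
  refine le_upperCorrDimMeasure_map_coinMeasure hπ hρc measurable_freeMask
    (tendsto_factorial_two_mul_add_atTop 2) (tendsto_window_end_ratio β) (fun j => ?_) ?_
  · refine ⟨freeLevelsBelow α β _, ?_, fun x y => eq_of_freeMask_eq⟩
    have := le_card_freeLevelsBelow h0 h h1 (Nat.factorial (2 * j + 2))
    have := le_cumulativeDensity_window_end h0 h j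
    linarith
  · obtain ⟨C, hC, hCr⟩ := exists_le_corrIntegral hπ hρc hc ν one_ne_zero hβ0 (n₀ := 0)
      fun n _ => ⟨_, _, determines_homogeneousSet n,
        (card_freeLevelsBelow_le h0 h h1 n).trans (cumulativeDensity_le h n), hνA.ge⟩
    filter_upwards [hCr, self_mem_nhdsWithin] with r hr hr0
    exact (mul_pos hC (Real.rpow_pos_of_pos hr0 _)).trans_le hr

lemma upperCorrDimMeasure_le_of_nonatomic [SecondCountableTopology X] (hπ : IsCantorCoding ρ κ π)
    (hρc : ρ ^ c = 2⁻¹) (hc : 0 < c) (hβ : 0 < β) (μ : Measure X) [IsProbabilityMeasure μ]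
    (hμ : ∀ x, μ {x} = 0) (hμB : μ (π '' exclusiveSet z)ᶜ = 0) :
    upperCorrDimMeasure μ ≤ ((β * c : ℝ) : EReal) := by
  obtain ⟨ε, δ, hε, hδ, hS⟩ := exists_le_measure_disjoint_of_nonatomic μ hμ
  obtain ⟨j₁, hj₁⟩ := exists_pow_lt_of_lt_one hε hπ.lt_one
  -- `j₁` makes the excluded cylinder smaller than `ε`; `j₂` ensures `(2 * j)! ≤ β * (2 * j + 1)!`.
  obtain ⟨j₂, hj₂⟩ := exists_nat_gt β⁻¹
  refine upperCorrDimMeasure_le hπ hρc hc μ hδ hβ.le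
    (n₀ := Nat.factorial (2 * max j₁ j₂ + 1)) fun n hn => ?_
  obtain ⟨j, hj, hjn, hnj⟩ := exists_window_scale hn
  refine ⟨_, _, determines_exclusiveSet_diff_cylinder (z := z) hnj.le, ?_, ?_⟩
  · rw [Finset.card_range]
    have h1 : (j₂ : ℝ) ≤ j := by exact_mod_cast (le_max_right _ _).trans hj
    have h2 : 1 ≤ β * (2 * j + 1) := by
      rw [← div_le_iff₀' hβ, one_div]
      have : (0 : ℝ) ≤ j := j.cast_nonneg
      linarith
    calc ((Nat.factorial (2 * j) : ℕ) : ℝ) ≤ β * (2 * j + 1) * Nat.factorial (2 * j) :=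
          le_mul_of_one_le_left (by positivity) h2
      _ = β * (Nat.factorial (2 * j + 1) : ℕ) := by
          rw [Nat.factorial_succ]; push_cast; ring
      _ ≤ β * n := by gcongr
  · obtain ⟨B, hδB, hB⟩ := hS (π '' PiNat.cylinder (z j) j) (by
      refine Metric.ediam_le ?_
      rintro _ ⟨x, hx, rfl⟩ _ ⟨y, hy, rfl⟩
      rw [edist_dist]
      refine ENNReal.ofReal_le_ofReal ((hπ.dist_le x y j fun i hi => ?_).trans ?_)
      · rw [hx i hi, hy i hi]
      · exact (pow_le_pow_of_le_one hπ.pos.le hπ.lt_one.le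
          ((le_max_left _ _).trans hj)).trans hj₁.le)
    refine hδB.trans (measure_mono_ae ?_)
    filter_upwards [measure_eq_zero_iff_ae_notMem.1 hμB] with w hw hwB
    obtain ⟨x, hx, rfl⟩ := not_not.1 hw
    exact ⟨x, ⟨hx, fun hcyl => Set.disjoint_left.1 hB hwB ⟨x, hcyl, rfl⟩⟩, rfl⟩

lemma upperCorrDim_union_le [SecondCountableTopology X] (hπ : IsCantorCoding ρ κ π)
    (hρc : ρ ^ c = 2⁻¹) (hc : 0 < c) (h0 : 0 ≤ α) (hβ : 0 < β) (h : α ≤ β) (h1 : β ≤ 1) :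
    upperCorrDim (π '' homogeneousSet α β ∪ π '' exclusiveSet z) ≤ ((β * c : ℝ) : EReal) := by
  refine iSup_le fun μ => iSup₂_le fun hprob hμE => ?_
  by_cases hA : μ (π '' homogeneousSet α β) = 0
  · by_cases hatom : ∀ x, μ {x} = 0
    · refine upperCorrDimMeasure_le_of_nonatomic (z := z) hπ hρc hc hβ μ hatom ?_
      refine measure_mono_null (fun x hx => ?_) (measure_union_null hA hμE)
      by_cases hxA : x ∈ π '' homogeneousSet α β
      · exact Or.inl hxA
      · exact Or.inr fun hxE => hxE.elim hxA hx
    · push Not at hatom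
      obtain ⟨x, hx⟩ := hatom
      have hxE : x ∈ range π := by
        by_contra hxE
        refine hx (measure_mono_null (singleton_subset_iff.2 fun hxE' => ?_) hμE)
        exact hxE (union_subset (image_subset_range _ _) (image_subset_range _ _) hxE')
      obtain ⟨w, rfl⟩ := hxE
      -- An atom is a carrier of fixed mass that needs no coordinates at any scale.
      refine upperCorrDimMeasure_le hπ hρc hc μ hx hβ.le (n₀ := 0) fun n _ =>
        ⟨{w}, ∅, ?_, by simp; positivity, by simp⟩
      rintro x rfl y rfl _ i _
      rfl
  · exact upperCorrDimMeasure_le hπ hρc hc μ hA hβ.le (n₀ := 0) fun n _ =>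
      ⟨_, _, determines_homogeneousSet n,
        (card_freeLevelsBelow_le h0 h h1 n).trans (cumulativeDensity_le h n), le_rfl⟩

end Union

/-! ### Choice of the ratio and conclusion -/

lemma exists_ratio_of_dimension {c : ℝ} (h0 : 0 < c) (h1 : c < 1) :
    ∃ ρ : ℝ, 0 < ρ ∧ ρ < 1 / 2 ∧ ρ ^ c = 2⁻¹ := by
  refine ⟨2⁻¹ ^ (1 / c), by positivity, ?_, ?_⟩
  · have := Real.rpow_lt_rpow_of_exponent_gt (x := (2⁻¹ : ℝ)) (by norm_num) (by norm_num)
      ((one_lt_div h0).2 h1)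
    rw [Real.rpow_one] at this
    simpa using this
  · rw [← Real.rpow_mul (by norm_num), one_div_mul_cancel h0.ne', Real.rpow_one]

end FractalDim

open FractalDim in
theorem mainTheorem5 (d : ℕ) (hd : 1 ≤ d) (a b c : ℝ)
    (ha : 0 < a) (hab : a < b) (hbc : b < c) (hc : c < 1) :
    ∃ E : Set (EuclideanSpace ℝ (Fin d)), IsCompact E ∧
      FractalDim.modifiedLowerBoxDim E = (a : EReal) ∧
      FractalDim.upperCorrDim E = (b : EReal) ∧
      FractalDim.packingDim E = (c : EReal) := by
  have hb0 : 0 < b := ha.trans hab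
  have hc0 : 0 < c := hb0.trans hbc
  have : Nonempty (Fin d) := ⟨⟨0, hd⟩⟩
  obtain ⟨ρ, hρ0, hρ, hρc⟩ := exists_ratio_of_dimension hc0 hc
  obtain ⟨κ, π, hπ⟩ := exists_isCantorCoding hd hρ0 hρ
  obtain ⟨z, hz⟩ := exists_seq_frequently_finset
  -- Densities are relative to the full binary tree, whose coded dimension is `c`.
  have h0 : 0 ≤ a / c := by positivity
  have hβ : 0 < b / c := by positivity
  have h : a / c ≤ b / c := by gcongr
  have h1 : b / c ≤ 1 := (div_le_one hc0).2 hbc.le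
  have hac : a / c * c = a := div_mul_cancel₀ a hc0.ne'
  have hbc' : b / c * c = b := div_mul_cancel₀ b hc0.ne'
  refine ⟨π '' homogeneousSet (a / c) (b / c) ∪ π '' exclusiveSet z, ?_, ?_, ?_, ?_⟩
  · exact (isClosed_homogeneousSet.isCompact.image hπ.continuous).union
      (isClosed_exclusiveSet.isCompact.image hπ.continuous)
  · refine le_antisymm ?_ ?_
    · simpa only [hac] using modifiedLowerBoxDim_union_le (z := z) hπ hρc h0 h h1
    · simpa only [hac] using le_modifiedLowerBoxDim hπ hρc hc0 h0 h h1 subset_union_left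
  · refine le_antisymm ?_ ?_
    · simpa only [hbc'] using upperCorrDim_union_le (z := z) hπ hρc hc0 h0 hβ h h1
    · simpa only [hbc'] using le_upperCorrDim hπ hρc hc0 h0 h h1 subset_union_left
  · refine le_antisymm (packingDim_le hπ hρc hc0 ?_) ?_
    · exact union_subset (image_subset_range _ _) (image_subset_range _ _)
    · exact le_packingDim hπ hρc hc0 (hasFullScales_exclusiveSet hz) isClosed_exclusiveSet
        ⟨_, zero_mem_exclusiveSet⟩ subset_union_right
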